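/- Let $n=m+s$. Let $q\in\mathbb R^n$ and $\mathbf p\in\mathbb R^n$ denote configuration and momentum, and consider the mechanical system $$\dot q = M^{-1}\mathbf M_d\nabla_{\mathbf p}\mathbf H_d,\qquad \dot{\mathbf p} = -\mathbf M_dM^{-1}\nabla_q\mathbf H_d+(\mathbf J_2-GK_pG^\top)\nabla_{\mathbf p}\mathbf H_d+G(u-d),\qquad \mathbf y=G^\top\nabla_{\mathbf p}\mathbf H_d, \tag{1}$$ $$\mathbf H_d(q,\mathbf p)=\tfrac12\mathbf p^\top\mathbf M_d^{-1}(q)\mathbf p+V_d(q),$$ with input $u\in\mathbb R^m$ and constant disturbance $d\in\mathbb R^m$, where for all $q,\mathbf p$: $M(q)$ and $\mathbf M_d(q)$ are symmetric positive definite, $G(q)\in\mathbb R^{n\times m}$ has rank $m$, $K_p(q)\in\mathbb R^{m\times m}$ is symmetric positive semidefinite and $\mathbf J_2(q,\mathbf p)$ is skew-symmetric; $M,K_p,\mathbf J_2$ are $C^1$ and $\mathbf M_d,V_d,G$ are $C^2$. Assume that $\mathbf H_d$ has a strict local minimum at $(q^\star,0)$. Let $G^\perp(q)\in\mathbb R^{s\times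 n}$ be $C^2$ in $q$, of rank $s$, with $G^\perp G=0$, and put $$T=\begin{bmatrix}(G^\top G)^{-1}G^\top\\ G^\perp\end{bmatrix},\quad p=\begin{bmatrix}p_1\\p_2\end{bmatrix}=T(q)\mathbf p,\quad \mathcal H_d(q,p_1,p_2)=\tfrac12p^\top(T\mathbf M_dT^\top)^{-1}p+V_d(q),$$ $$S_1=M^{-1}\mathbf M_dG(G^\top G)^{-1},\quad S_2=M^{-1}\mathbf M_dG^{\perp\top},\quad S_{32}=(G^\top G)^{-1}G^\top J_pG^{\perp\top},\quad S_{34}=G^\perp J_pG^{\perp\top},$$ $$J_p=\mathbf M_dM^{-1}B^\top-BM^{-1}\mathbf M_d+\mathbf J_2(q,T^{-1}p),\qquad B=\frac{\partial\,(T^{-1}(q)p)}{\partial q}\ \text{(Jacobian, } p \text{ fixed)}.$$ Let $K_I,R_{c_1},R_{c_2}\in\mathbb R^{m\times m}$ be constant symmetric positive definite matrices and $J_{c_1}\in\mathbb R^{m\times m}$ a constant skew-symmetric matrix, let $d\in\mathbb R^m$ be arbitrary, and let $\mathcal H_{cl}(q,p_1,p_2,\zeta)=\mathcal H_d(q,p_1,p_2)+\tfrac12(p_1-\zeta)^\top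 K_I(p_1-\zeta)$. The closed loop with integral action is $$\begin{bmatrix}\dot q\\\dot p_1\\\dot p_2\\\dot\zeta\end{bmatrix}=\begin{bmatrix}0&S_1&S_2&S_1\\-S_1^\top&J_{c_1}-R_{c_1}-R_{c_2}&S_{32}&-R_{c_2}\\-S_2^\top&-S_{32}^\top&S_{34}&-S_{32}^\top\\-S_1^\top&-R_{c_2}&S_{32}&-R_{c_2}\end{bmatrix}\nabla\mathcal H_{cl}-\begin{bmatrix}0\\d\\0\\0\end{bmatrix}. \tag{2}$$ Suppose that the output $\mathbf y$ of (1) is detectable when $d=0$ and $u=0$; that is, there is a neighbourhood $N$ of $(q^\star,0)$ such that every solution $(q,\mathbf p):[0,\infty)\to\mathbb R^{2n}$ of (1) with $u=d=0$ that starts in $N$ and satisfies $\mathbf y(t)=0$ for all $t\ge0$ converges to $(q^\star,0)$ as $t\to\infty$. Then $$(q,p_1,p_2,\zeta)=\bigl(q^\star,0,0,-K_I^{-1}(J_{c_1}-R_{c_1})^{-1}d\bigr)$$ is an asymptotically stable equilibrium of (2): it is an equilibrium, it is Lyapunov stable (solutions of (2) starting near it exist for all $t\ge0$ and remain near it), and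 all solutions starting sufficiently near it converge to it. -/

import Mathlib

open scoped Matrix Topology

noncomputable section

namespace IDAPBC

/-! ### Autonomous systems: solutions, stability, detectability -/

section Dynamics

variable {E Y : Type*} [NormedAddCommGroup E] [NormedSpace ℝ E] [Zero Y]

/-- `x` solves `ẋ = f x` on the time interval `[0, ∞)` (one-sided derivative at `0`). -/
def IsSolution (f : E → E) (x : ℝ → E) : Prop :=
  ∀ t : ℝ, 0 ≤ t → HasDerivWithinAt x (f (x t)) (Set.Ici 0) t

/-- Lyapunov stability: for each neighbourhood `U` of `xs`, the motions that start close enough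
to `xs` exist for all `t ≥ 0` and never leave `U`. -/
def IsStable (f : E → E) (xs : E) : Prop :=
  ∀ U ∈ 𝓝 xs, ∃ V ∈ 𝓝 xs, ∀ x₀ ∈ V,
    (∃ x, IsSolution f x ∧ x 0 = x₀) ∧
    ∀ x, IsSolution f x → x 0 = x₀ → ∀ t : ℝ, 0 ≤ t → x t ∈ U

/-- Asymptotic stability of the equilibrium `xs`: Lyapunov stability and local attractivity. -/
def IsAsymptoticallyStable (f : E → E) (xs : E) : Prop :=
  f xs = 0 ∧ IsStable f xs ∧
    ∃ V ∈ 𝓝 xs, ∀ x, IsSolution f x → x 0 ∈ V → Filter.Tendsto x Filter.atTop (𝓝 xs)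

/-- (Local) detectability of the output `y = h x` of `ẋ = f x` with respect to `xs`: motions
starting near `xs` along which the output vanishes identically converge to `xs`. -/
def IsDetectable (f : E → E) (h : E → Y) (xs : E) : Prop :=
  ∃ N ∈ 𝓝 xs, ∀ x, IsSolution f x → x 0 ∈ N → (∀ t : ℝ, 0 ≤ t → h (x t) = 0) →
    Filter.Tendsto x Filter.atTop (𝓝 xs)

end Dynamics

/-- The gradient of `f` at `x`, as the vector of partial derivatives. -/
def grad {ι : Type*} [Fintype ι] [DecidableEq ι] (f : (ι → ℝ) → ℝ) (x : ι → ℝ) : ι → ℝ :=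
  fun i => fderiv ℝ f x (Pi.single i 1)

/-- The Jacobian matrix of `f` at `x`: entry `(i, j)` is `∂f_i / ∂x_j`. -/
def jacobian {ι κ : Type*} [Fintype ι] [DecidableEq ι] (f : (ι → ℝ) → κ → ℝ) (x : ι → ℝ) :
    Matrix κ ι ℝ :=
  Matrix.of fun i => grad (fun x' => f x' i) x

/-! ### The mechanical system stabilised by IDA-PBC -/

/-- The Hamiltonian `½ pᵀ Md(q)⁻¹ p + Vd(q)`. -/
def hamiltonian {n : ℕ} (Md : (Fin n → ℝ) → Matrix (Fin n) (Fin n) ℝ) (Vd : (Fin n → ℝ) → ℝ)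
    (q p : Fin n → ℝ) : ℝ :=
  (1 / 2 : ℝ) * (p ⬝ᵥ ((Md q)⁻¹ *ᵥ p)) + Vd q

/-- Data and standing assumptions of a mechanical system with `n` degrees of freedom and `m`
inputs that has been stabilised by IDA-PBC. -/
structure MechSystem (n m : ℕ) where
  /-- open-loop mass matrix -/
  M : (Fin n → ℝ) → Matrix (Fin n) (Fin n) ℝ
  /-- shaped mass matrix -/
  Md : (Fin n → ℝ) → Matrix (Fin n) (Fin n) ℝ
  /-- shaped potential energy -/
  Vd : (Fin n → ℝ) → ℝ
  /-- input matrix -/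
  G : (Fin n → ℝ) → Matrix (Fin n) (Fin m) ℝ
  /-- damping gain -/
  Kp : (Fin n → ℝ) → Matrix (Fin m) (Fin m) ℝ
  /-- gyroscopic term -/
  J2 : (Fin n → ℝ) → (Fin n → ℝ) → Matrix (Fin n) (Fin n) ℝ
  /-- desired configuration -/
  qstar : Fin n → ℝ
  M_contDiff : ∀ i j, ContDiff ℝ 1 fun q => M q i j
  Md_contDiff : ∀ i j, ContDiff ℝ 2 fun q => Md q i j
  Vd_contDiff : ContDiff ℝ 2 Vd
  G_contDiff : ∀ i j, ContDiff ℝ 2 fun q => G q i j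
  Kp_contDiff : ∀ i j, ContDiff ℝ 1 fun q => Kp q i j
  J2_contDiff : ∀ i j, ContDiff ℝ 1 fun x : (Fin n → ℝ) × (Fin n → ℝ) => J2 x.1 x.2 i j
  M_posDef : ∀ q, (M q).PosDef
  Md_posDef : ∀ q, (Md q).PosDef
  G_rank : ∀ q, (G q).rank = m
  Kp_posSemidef : ∀ q, (Kp q).PosSemidef
  J2_skew : ∀ q p, (J2 q p)ᵀ = -J2 q p
  /-- the Hamiltonian has a strict (local) minimum at `(qstar, 0)` -/
  strict_min : ∀ᶠ x in 𝓝[≠] ((qstar, 0) : (Fin n → ℝ) × (Fin n → ℝ)),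
    hamiltonian Md Vd qstar 0 < hamiltonian Md Vd x.1 x.2

namespace MechSystem

variable {n m s : ℕ} (P : MechSystem n m)

/-- The Hamiltonian in the original momenta. -/
def H (q p : Fin n → ℝ) : ℝ :=
  hamiltonian P.Md P.Vd q p

/-- The damping matrix `G Kp Gᵀ`. -/
def Rd (q : Fin n → ℝ) : Matrix (Fin n) (Fin n) ℝ :=
  P.G q * P.Kp q * (P.G q)ᵀ

/-- The original system with input `u` and disturbance `d`, on the state `(q, p)`. -/
def openLoop (u d : Fin m → ℝ) (x : (Fin n → ℝ) × (Fin n → ℝ)) :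
    (Fin n → ℝ) × (Fin n → ℝ) :=
  let q := x.1
  let p := x.2
  let gq := grad (fun q' => P.H q' p) q
  let gp := grad (fun p' => P.H q p') p
  (((P.M q)⁻¹ * P.Md q) *ᵥ gp,
    -((P.Md q * (P.M q)⁻¹) *ᵥ gq) + (P.J2 q p - P.Rd q) *ᵥ gp + P.G q *ᵥ (u - d))

/-- The passive output `Gᵀ ∇ₚ H` of the original system. -/
def output (x : (Fin n → ℝ) × (Fin n → ℝ)) : Fin m → ℝ :=
  (P.G x.1)ᵀ *ᵥ grad (fun p' => P.H x.1 p') x.2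

/-! ### The momentum transformation `(q, p) ↦ (q, T(q) p)` -/

variable (Gp : (Fin n → ℝ) → Matrix (Fin s) (Fin n) ℝ)

/-- The upper block `(Gᵀ G)⁻¹ Gᵀ` of the transformation matrix. -/
def Gdag (q : Fin n → ℝ) : Matrix (Fin m) (Fin n) ℝ :=
  ((P.G q)ᵀ * P.G q)⁻¹ * (P.G q)ᵀ

/-- The transformation matrix `T`, with blocks `(Gᵀ G)⁻¹ Gᵀ` and the annihilator `Gp`. -/
def T (q : Fin n → ℝ) : Matrix (Fin m ⊕ Fin s) (Fin n) ℝ :=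
  Matrix.fromRows (P.Gdag q) (Gp q)

/-- The inverse of `T`; see `T_mul_Tinv` and `Tinv_mul_T`. -/
def Tinv (q : Fin n → ℝ) : Matrix (Fin n) (Fin m ⊕ Fin s) ℝ :=
  Matrix.fromCols (P.G q) ((Gp q)ᵀ * (Gp q * (Gp q)ᵀ)⁻¹)

theorem isUnit_of_rank {k : ℕ} (A : Matrix (Fin k) (Fin k) ℝ) (h : A.rank = k) : IsUnit A := by
  have h' : Function.Surjective A.mulVecLin := by
    rw [← LinearMap.range_eq_top]
    apply Submodule.eq_top_of_finrank_eq
    rw [← Matrix.rank, h]; simp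
  exact Matrix.mulVec_surjective_iff_isUnit.1 h'

theorem T_mul_Tinv (hrank : ∀ q, (Gp q).rank = s) (hann : ∀ q, Gp q * P.G q = 0)
    (q : Fin n → ℝ) : P.T Gp q * P.Tinv Gp q = 1 := by
  have h1 : IsUnit ((P.G q)ᵀ * P.G q) := by
    refine isUnit_of_rank _ ?_
    rw [Matrix.rank_transpose_mul_self, P.G_rank q]
  have h2 : IsUnit (Gp q * (Gp q)ᵀ) := by
    refine isUnit_of_rank _ ?_
    rw [Matrix.rank_self_mul_transpose, hrank q]
  have h3 : (P.G q)ᵀ * (Gp q)ᵀ = 0 := by rw [← Matrix.transpose_mul, hann q]; simp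
  rw [Matrix.isUnit_iff_isUnit_det] at h1 h2
  rw [T, Tinv, Matrix.fromRows_mul_fromCols, ← Matrix.fromBlocks_one]
  congr 1
  · rw [Gdag, Matrix.mul_assoc, Matrix.nonsing_inv_mul _ h1]
  · rw [Gdag, Matrix.mul_assoc, ← Matrix.mul_assoc (P.G q)ᵀ, h3]; simp
  · exact hann q
  · rw [← Matrix.mul_assoc, Matrix.mul_nonsing_inv _ h2]

theorem Tinv_mul_T (hns : m + s = n) (hrank : ∀ q, (Gp q).rank = s)
    (hann : ∀ q, Gp q * P.G q = 0) (q : Fin n → ℝ) : P.Tinv Gp q * P.T Gp q = 1 :=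
  (Matrix.mul_eq_one_comm_of_card_eq _ _ _ (by simp [hns])).1 (P.T_mul_Tinv Gp hrank hann q)

/-- The shaped mass matrix `T Md Tᵀ` in the new momenta. -/
def MdT (q : Fin n → ℝ) : Matrix (Fin m ⊕ Fin s) (Fin m ⊕ Fin s) ℝ :=
  P.T Gp q * P.Md q * (P.T Gp q)ᵀ

/-- The Hamiltonian in the new momenta `p = col(p₁, p₂)`. -/
def HT (q : Fin n → ℝ) (p₁ : Fin m → ℝ) (p₂ : Fin s → ℝ) : ℝ :=
  (1 / 2 : ℝ) * (Sum.elim p₁ p₂ ⬝ᵥ ((P.MdT Gp q)⁻¹ *ᵥ Sum.elim p₁ p₂)) + P.Vd q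

/-- `S₁ = M⁻¹ Md G (Gᵀ G)⁻¹` -/
def S1 (q : Fin n → ℝ) : Matrix (Fin n) (Fin m) ℝ :=
  (P.M q)⁻¹ * P.Md q * P.G q * ((P.G q)ᵀ * P.G q)⁻¹

/-- `S₂ = M⁻¹ Md Gpᵀ` -/
def S2 (q : Fin n → ℝ) : Matrix (Fin n) (Fin s) ℝ :=
  (P.M q)⁻¹ * P.Md q * (Gp q)ᵀ

/-- `J_p = Md M⁻¹ Bᵀ - B M⁻¹ Md + J₂(q, T⁻¹ p)`, where `B` is the Jacobian of
`q ↦ T⁻¹(q) p` with `p` held fixed. -/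
def Jp (q : Fin n → ℝ) (p₁ : Fin m → ℝ) (p₂ : Fin s → ℝ) : Matrix (Fin n) (Fin n) ℝ :=
  let p : Fin m ⊕ Fin s → ℝ := Sum.elim p₁ p₂
  let B : Matrix (Fin n) (Fin n) ℝ := jacobian (fun q' => P.Tinv Gp q' *ᵥ p) q
  P.Md q * (P.M q)⁻¹ * Bᵀ - B * (P.M q)⁻¹ * P.Md q + P.J2 q (P.Tinv Gp q *ᵥ p)

/-- `S₃₂ = (Gᵀ G)⁻¹ Gᵀ J_p Gpᵀ` -/
def S32 (q : Fin n → ℝ) (p₁ : Fin m → ℝ) (p₂ : Fin s → ℝ) : Matrix (Fin m) (Fin s) ℝ :=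
  P.Gdag q * P.Jp Gp q p₁ p₂ * (Gp q)ᵀ

/-- `S₃₄ = Gp J_p Gpᵀ` -/
def S34 (q : Fin n → ℝ) (p₁ : Fin m → ℝ) (p₂ : Fin s → ℝ) : Matrix (Fin s) (Fin s) ℝ :=
  Gp q * P.Jp Gp q p₁ p₂ * (Gp q)ᵀ

/-! ### The integral-action closed loop -/

/-- The controller energy `½ (p₁ - ζ)ᵀ K_I (p₁ - ζ)`. -/
def Hc (KI : Matrix (Fin m) (Fin m) ℝ) (p₁ ζ : Fin m → ℝ) : ℝ :=
  (1 / 2 : ℝ) * ((p₁ - ζ) ⬝ᵥ (KI *ᵥ (p₁ - ζ)))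

/-- The closed-loop Hamiltonian. -/
def Hcl (KI : Matrix (Fin m) (Fin m) ℝ) (q : Fin n → ℝ) (p₁ : Fin m → ℝ) (p₂ : Fin s → ℝ)
    (ζ : Fin m → ℝ) : ℝ :=
  P.HT Gp q p₁ p₂ + Hc KI p₁ ζ

/-- The closed loop with integral action under the constant disturbance `d`, in
port-Hamiltonian form, on the state `(q, p₁, p₂, ζ)`. The interconnection and damping matrix is
`[[0, S₁, S₂, S₁], [-S₁ᵀ, J-R₁-R₂, S₃₂, -R₂], [-S₂ᵀ, -S₃₂ᵀ, S₃₄, -S₃₂ᵀ], [-S₁ᵀ, -R₂, S₃₂, -R₂]]`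
and it multiplies the gradient of the closed-loop Hamiltonian. -/
def closedLoop (KI Jc1 Rc1 Rc2 : Matrix (Fin m) (Fin m) ℝ) (d : Fin m → ℝ)
    (x : (Fin n → ℝ) × (Fin m → ℝ) × (Fin s → ℝ) × (Fin m → ℝ)) :
    (Fin n → ℝ) × (Fin m → ℝ) × (Fin s → ℝ) × (Fin m → ℝ) :=
  let q := x.1
  let p₁ := x.2.1
  let p₂ := x.2.2.1
  let ζ := x.2.2.2
  let gq := grad (fun q' => P.Hcl Gp KI q' p₁ p₂ ζ) q
  let g₁ := grad (fun p' => P.Hcl Gp KI q p' p₂ ζ) p₁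
  let g₂ := grad (fun p' => P.Hcl Gp KI q p₁ p' ζ) p₂
  let gζ := grad (fun ζ' => P.Hcl Gp KI q p₁ p₂ ζ') ζ
  let S₁ := P.S1 q
  let S₂ := P.S2 Gp q
  let S₃₂ := P.S32 Gp q p₁ p₂
  let S₃₄ := P.S34 Gp q p₁ p₂
  (S₁ *ᵥ g₁ + S₂ *ᵥ g₂ + S₁ *ᵥ gζ,
    -(S₁ᵀ *ᵥ gq) + (Jc1 - Rc1 - Rc2) *ᵥ g₁ + S₃₂ *ᵥ g₂ - Rc2 *ᵥ gζ - d,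
    -(S₂ᵀ *ᵥ gq) - S₃₂ᵀ *ᵥ g₁ + S₃₄ *ᵥ g₂ - S₃₂ᵀ *ᵥ gζ,
    -(S₁ᵀ *ᵥ gq) - Rc2 *ᵥ g₁ + S₃₂ *ᵥ g₂ - Rc2 *ᵥ gζ)

/-- The desired closed-loop equilibrium `(q⋆, 0, 0, -K_I⁻¹ (J_{c1} - R_{c1})⁻¹ d)`. -/
def equilibrium (s : ℕ) (KI Jc1 Rc1 : Matrix (Fin m) (Fin m) ℝ) (d : Fin m → ℝ) :
    (Fin n → ℝ) × (Fin m → ℝ) × (Fin s → ℝ) × (Fin m → ℝ) :=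
  (P.qstar, 0, 0, -(KI⁻¹ *ᵥ ((Jc1 - Rc1)⁻¹ *ᵥ d)))

end MechSystem

end IDAPBC

end

/-! Put c = K_I⁻¹(J_{c1} - R_{c1})⁻¹d. The mechanical energy plus the controller energy ½(p₁ - c -
ζ)ᵀK_I(p₁ - c - ζ) is a Lyapunov function W with a strict local minimum at the target. With a =
∂H_d/∂p₁ and w = K_I(p₁ - c - ζ), the choice of c absorbs d, the coupling blocks cancel by skewness,
and Ẇ = -(a + w)ᵀR_{c1}(a + w) - aᵀR_{c2}a (`power_balance`, `fderiv_lyapunov_closedLoop`).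

Where Ẇ = 0, positive definiteness gives a = 0 and w = 0. The first block column of T⁻¹ is G, so a
is the passive output y (`grad_HT_p₁`). On this set the closed loop, mapped back by (q, p) ↦ (q,
T⁻¹p), is system (1) with u = d = 0 (`openLoop_toPhase`). A motion with Ẇ ≡ 0 is therefore a motion
of (1) with zero output; detectability sends (q, p) to (q⋆, 0), and ζ = p₁ - c follows.

LaSalle's principle (`isAsymptoticallyStable_of_lyapunov`) concludes. It asks only that motions with
Ẇ ≡ 0 starting near the target converge to it, and it yields the equilibrium property as well. It is
proved for C¹ fields by cutting the field off outside a ball, which makes it globally Lipschitz and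
forward complete. -/

noncomputable section

namespace IDAPBC

/-! ### Lyapunov stability and LaSalle's principle for C¹ fields. -/

section Dynamics

variable {E : Type*} [NormedAddCommGroup E] [NormedSpace ℝ E]

namespace IsSolution

variable {f : E → E} {x y : ℝ → E}

theorem continuousOn (hx : IsSolution f x) : ContinuousOn x (Set.Ici 0) :=
  fun t ht => (hx t ht).continuousWithinAt

theorem hasDerivWithinAt_Ici (hx : IsSolution f x) {t : ℝ} (ht : 0 ≤ t) :
    HasDerivWithinAt x (f (x t)) (Set.Ici t) t :=
  (hx t ht).mono (Set.Ici_subset_Ici.2 ht)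

theorem comp_add_const (hx : IsSolution f x) {a : ℝ} (ha : 0 ≤ a) :
    IsSolution f fun t => x (t + a) := by
  intro t ht
  have h := hx (t + a) (by positivity)
  have h2 := h.scomp t (t' := Set.Ici 0) (((hasDerivAt_id t).add_const a).hasDerivWithinAt)
    (fun u hu => add_nonneg hu ha)
  rwa [one_smul] at h2

/-- Serves to exchange a field for its cut-off along motions confined to the ball where the two
agree. -/
theorem congr_field {g : E → E} (hx : IsSolution f x) (h : ∀ t, 0 ≤ t → f (x t) = g (x t)) :
    IsSolution g x := fun t ht => h t ht ▸ hx t ht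

/-- Continuous dependence of solutions on the initial value. -/
theorem dist_le {K : NNReal} (hf : LipschitzWith K f) (hx : IsSolution f x)
    (hy : IsSolution f y) {t : ℝ} (ht : 0 ≤ t) :
    dist (x t) (y t) ≤ dist (x 0) (y 0) * Real.exp (K * t) := by
  have h := dist_le_of_trajectories_ODE (v := fun _ => f) (a := 0) (b := t) (fun _ => hf)
    (hx.continuousOn.mono Set.Icc_subset_Ici_self) (fun s hs => hx.hasDerivWithinAt_Ici hs.1)
    (hy.continuousOn.mono Set.Icc_subset_Ici_self) (fun s hs => hy.hasDerivWithinAt_Ici hs.1)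
    le_rfl t ⟨ht, le_rfl⟩
  simpa using h

theorem hasDerivWithinAt_comp (hx : IsSolution f x) {W : E → ℝ} (hW : Differentiable ℝ W)
    {t : ℝ} (ht : 0 ≤ t) :
    HasDerivWithinAt (fun s => W (x s)) (fderiv ℝ W (x t) (f (x t))) (Set.Ici 0) t :=
  (hW (x t)).hasFDerivAt.comp_hasDerivWithinAt t (hx t ht)

theorem antitoneOn (hx : IsSolution f x) {W : E → ℝ} (hW : Differentiable ℝ W)
    (hdec : ∀ z, fderiv ℝ W z (f z) ≤ 0) :
    AntitoneOn (fun t => W (x t)) (Set.Ici 0) := by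
  refine antitoneOn_of_hasDerivWithinAt_nonpos (convex_Ici 0)
    (fun t ht => (hx.hasDerivWithinAt_comp hW ht).continuousWithinAt)
    (fun t ht => (hx.hasDerivWithinAt_comp hW (interior_subset ht)).mono interior_subset)
    fun t _ => hdec _

/-- A solution that starts in a ball, at a level of `W` below all levels on the sphere, never
leaves the ball. -/
theorem mem_ball_of_lt (hx : IsSolution f x) {W : E → ℝ} (hW : Differentiable ℝ W)
    (hdec : ∀ z, fderiv ℝ W z (f z) ≤ 0) {xs : E} {r α : ℝ}
    (hα : ∀ z ∈ Metric.sphere xs r, α ≤ W z) (h0 : x 0 ∈ Metric.ball xs r) (hW0 : W (x 0) < α)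
    {t : ℝ} (ht : 0 ≤ t) : x t ∈ Metric.ball xs r := by
  by_contra hout
  -- Leaving the ball means crossing the sphere at some time `s`, where `W` is at least `α`; but `W`
  -- cannot have grown past its initial value.
  have hcont : ContinuousOn (fun s => dist (x s) xs) (Set.Icc 0 t) :=
    (continuous_id.dist continuous_const).comp_continuousOn
      (hx.continuousOn.mono Set.Icc_subset_Ici_self)
  obtain ⟨s, hs, hsr⟩ := intermediate_value_Icc ht hcont
    ⟨(Metric.mem_ball.1 h0).le, not_lt.1 hout⟩
  have h1 := hα (x s) hsr
  have h2 : W (x s) ≤ W (x 0) := hx.antitoneOn hW hdec Set.self_mem_Ici hs.1 hs.1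
  linarith

end IsSolution

/-- Bounded Lipschitz vector fields are forward complete. -/
theorem exists_isSolution_of_lipschitzWith [CompleteSpace E] {f : E → E} {K : NNReal}
    (hf : LipschitzWith K f) {L : NNReal} (hL : ∀ z, ‖f z‖ ≤ L) (x₀ : E) :
    ∃ x, IsSolution f x ∧ x 0 = x₀ := by
  have hloc : ∀ N : ℕ, ∃ α : ℝ → E, α 0 = x₀ ∧
      ∀ t ∈ Set.Icc (0 : ℝ) N, HasDerivWithinAt α (f (α t)) (Set.Icc 0 (N : ℝ)) t := by
    intro N
    -- Speed at most `L` cannot leave the ball of radius `L * N` within time `N`, so Picard–Lindelöf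
    -- applies on all of `[0, N]`.
    have hP : IsPicardLindelof (fun _ => f) (tmin := 0) (tmax := (N : ℝ))
        ⟨0, le_rfl, Nat.cast_nonneg N⟩ x₀ (L * N) 0 L K :=
      IsPicardLindelof.of_time_independent (fun z _ => hL z) hf.lipschitzOnWith (by simp)
    exact hP.exists_eq_forall_mem_Icc_hasDerivWithinAt₀
  choose α hα0 hα using hloc
  have hder : ∀ N : ℕ, ∀ t ∈ Set.Ico (0 : ℝ) N,
      HasDerivWithinAt (α N) (f (α N t)) (Set.Ici 0) t := by
    intro N t ht
    refine (hα N t ⟨ht.1, ht.2.le⟩).mono_of_mem_nhdsWithin ?_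
    rw [mem_nhdsWithin]
    exact ⟨Set.Iio N, isOpen_Iio, ht.2, fun u hu => ⟨hu.2, le_of_lt hu.1⟩⟩
  have hagree : ∀ N N' : ℕ, N ≤ N' → Set.EqOn (α N) (α N') (Set.Icc 0 (N : ℝ)) := by
    intro N N' hNN
    have hc : (N : ℝ) ≤ N' := by exact_mod_cast hNN
    refine ODE_solution_unique (v := fun _ => f) (fun _ => hf)
      (fun t ht => (hα N t ht).continuousWithinAt)
      (fun t ht => (hder N t ht).mono (Set.Ici_subset_Ici.2 ht.1))
      (fun t ht => ((hα N' t ⟨ht.1, ht.2.trans hc⟩).continuousWithinAt).mono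
        (Set.Icc_subset_Icc_right hc))
      (fun t ht => (hder N' t ⟨ht.1, ht.2.trans_le hc⟩).mono (Set.Ici_subset_Ici.2 ht.1)) ?_
    rw [hα0, hα0]
  -- The `+ 1` keeps `t` strictly below the right end of its interval, where the derivative within
  -- `Icc` is one within `Ici`.
  let x : ℝ → E := fun t => α (⌊t⌋₊ + 1) t
  have hx : ∀ N : ℕ, ∀ t ∈ Set.Ico (0 : ℝ) N, x t = α N t := by
    intro N t ht
    have h1 : ⌊t⌋₊ + 1 ≤ N := (Nat.floor_lt ht.1).2 ht.2
    exact hagree _ _ h1 ⟨ht.1, by push_cast; exact (Nat.lt_floor_add_one t).le⟩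
  refine ⟨x, fun t ht => ?_, hα0 _⟩
  have htN : t ∈ Set.Ico (0 : ℝ) ((⌊t⌋₊ + 1 : ℕ) : ℝ) :=
    ⟨ht, by push_cast; exact Nat.lt_floor_add_one t⟩
  refine (hder _ t htN).congr_of_eventuallyEq ?_ rfl
  filter_upwards [inter_mem_nhdsWithin (Set.Ici (0 : ℝ)) (Iio_mem_nhds htN.2)] with u hu
  exact hx _ u ⟨hu.1, hu.2⟩

/-- A `C¹` vector field agrees on a ball with a bounded Lipschitz field that is a multiple of it
by a function with values in `[0, 1]`. -/
theorem exists_lipschitzWith_eqOn_closedBall [FiniteDimensional ℝ E] {f : E → E}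
    (hf : ContDiff ℝ 1 f) (xs : E) {r : ℝ} (hr : 0 < r) :
    ∃ (φ : E → ℝ) (K L : NNReal), (∀ z, 0 ≤ φ z) ∧ (∀ z ∈ Metric.closedBall xs r, φ z = 1) ∧
      LipschitzWith K (fun z => φ z • f z) ∧ ∀ z, ‖φ z • f z‖ ≤ L := by
  let φ : ContDiffBump xs := ⟨r, r + 1, hr, by linarith⟩
  have hg : ContDiff ℝ 1 fun z => φ z • f z := φ.contDiff.smul hf
  have hs : HasCompactSupport fun z => φ z • f z := φ.hasCompactSupport.smul_right
  obtain ⟨C, hC⟩ := hs.exists_bound_of_continuous hg.continuous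
  obtain ⟨D, hD⟩ := (hs.fderiv (𝕜 := ℝ)).exists_bound_of_continuous (hg.continuous_fderiv one_ne_zero)
  refine ⟨φ, D.toNNReal, C.toNNReal, fun z => φ.nonneg, fun z hz => φ.one_of_mem_closedBall hz,
    ?_, fun z => (hC z).trans (Real.le_coe_toNNReal C)⟩
  refine lipschitzWith_of_nnnorm_fderiv_le (𝕜 := ℝ) (hg.differentiable one_ne_zero) fun z => ?_
  exact NNReal.coe_le_coe.1 ((hD z).trans (Real.le_coe_toNNReal D))

/-- The set of limit points of a solution is forward invariant. -/
theorem IsSolution.mapClusterPt {g : E → E} {K : NNReal} (hg : LipschitzWith K g)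
    {x y : ℝ → E} (hx : IsSolution g x) (hy : IsSolution g y)
    (hy0 : MapClusterPt (y 0) Filter.atTop x) {t : ℝ} (ht : 0 ≤ t) :
    MapClusterPt (y t) Filter.atTop x := by
  rw [mapClusterPt_iff_frequently]
  intro s hs
  obtain ⟨ε, hε, hεs⟩ := Metric.mem_nhds_iff.1 hs
  -- This radius compensates the Grönwall growth `exp (K * t)`: a motion passing this close to `y 0`
  -- is within `ε` of `y t` a time `t` later.
  have hδ : 0 < ε * Real.exp (-(K * t)) := by positivity
  have hfr := (mapClusterPt_iff_frequently.1 hy0) _ (Metric.ball_mem_nhds _ hδ)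
  rw [Filter.frequently_atTop] at hfr ⊢
  intro a
  obtain ⟨b, hb, hbx⟩ := hfr (max a 0)
  refine ⟨t + b, by linarith [le_max_left a 0], hεs ?_⟩
  have h := (hx.comp_add_const ((le_max_right a 0).trans hb)).dist_le hg hy ht
  have h2 : dist (x (0 + b)) (y 0) < ε * Real.exp (-(K * t)) := by simpa using hbx
  calc dist (x (t + b)) (y t) ≤ _ := h
    _ < ε * Real.exp (-(K * t)) * Real.exp (K * t) := by gcongr
    _ = ε := by rw [mul_assoc, ← Real.exp_add]; simp

/-- **LaSalle's invariance principle** for strict local minima of a Lyapunov function. -/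
theorem isAsymptoticallyStable_of_lyapunov [FiniteDimensional ℝ E] {f : E → E}
    (hf : ContDiff ℝ 1 f) {W : E → ℝ} (hW : Differentiable ℝ W) {xs : E}
    (hmin : ∀ᶠ z in 𝓝[≠] xs, W xs < W z) (hdec : ∀ z, fderiv ℝ W z (f z) ≤ 0)
    (hinv : ∃ N ∈ 𝓝 xs, ∀ x, IsSolution f x → x 0 ∈ N →
      (∀ t : ℝ, 0 ≤ t → fderiv ℝ W (x t) (f (x t)) = 0) → Filter.Tendsto x Filter.atTop (𝓝 xs)) :
    IsAsymptoticallyStable f xs := by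
  have : CompleteSpace E := FiniteDimensional.complete ℝ E
  have : ProperSpace E := FiniteDimensional.proper ℝ E
  have key : ∀ U ∈ 𝓝 xs, ∃ r > 0, Metric.closedBall xs r ⊆ U ∧
      (∀ z ∈ Metric.closedBall xs r, z ≠ xs → W xs < W z) ∧ ∃ V ∈ 𝓝 xs, xs ∈ V ∧
      ∀ g : E → E, (∀ z, fderiv ℝ W z (g z) ≤ 0) → ∀ x, IsSolution g x → x 0 ∈ V →
        ∀ t : ℝ, 0 ≤ t → x t ∈ Metric.closedBall xs r := by
    intro U hU
    rw [eventually_nhdsWithin_iff] at hmin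
    obtain ⟨r, hr, hrU⟩ := Metric.nhds_basis_closedBall.mem_iff.1 (Filter.inter_mem hU hmin)
    -- A level strictly above `W xs` that bounds `W` below on the sphere; this form of the
    -- compactness lemma also covers an empty sphere.
    obtain ⟨α, hα, hαs⟩ := (isCompact_sphere xs r).exists_forall_le' hW.continuous.continuousOn
      (a := W xs) fun z hz => (hrU (Metric.sphere_subset_closedBall hz)).2
        (Metric.ne_of_mem_sphere hz hr.ne')
    refine ⟨r, hr, fun z hz => (hrU hz).1, fun z hz => (hrU hz).2,
      Metric.ball xs r ∩ W ⁻¹' Set.Iio α,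
      Filter.inter_mem (Metric.ball_mem_nhds _ hr) (hW.continuous.continuousAt (Iio_mem_nhds hα)),
      ⟨Metric.mem_ball_self hr, hα⟩, ?_⟩
    intro g hg x hx h0 t ht
    exact Metric.ball_subset_closedBall (hx.mem_ball_of_lt hW hg hαs h0.1 h0.2 ht)
  have cut : ∀ r > 0, ∃ (g : E → E) (K : NNReal), LipschitzWith K g ∧
      (∀ z, fderiv ℝ W z (g z) ≤ 0) ∧ (∀ z ∈ Metric.closedBall xs r, g z = f z) ∧
      ∀ x₀, ∃ x, IsSolution g x ∧ x 0 = x₀ := by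
    intro r hr
    -- Multiplying by `φ ≥ 0` keeps the sign of the derivative of `W`, so the same trapping argument
    -- applies to the cut-off field.
    obtain ⟨φ, K, L, hφ0, hφ1, hK, hL⟩ := exists_lipschitzWith_eqOn_closedBall hf xs hr
    refine ⟨_, K, hK, fun z => ?_, fun z hz => by simp [hφ1 z hz],
      exists_isSolution_of_lipschitzWith hK hL⟩
    rw [map_smul]
    exact mul_nonpos_of_nonneg_of_nonpos (hφ0 z) (hdec z)
  have hstable : IsStable f xs := by
    intro U hU
    obtain ⟨r, hr, hrU, -, V, hV, -, hVr⟩ := key U hU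
    obtain ⟨g, K, -, hgdec, hgf, hgex⟩ := cut r hr
    refine ⟨V, hV, fun x₀ hx₀ => ⟨?_, fun x hx hx0 t ht =>
      hrU (hVr f hdec x hx (hx0 ▸ hx₀) t ht)⟩⟩
    obtain ⟨x, hx, hx0⟩ := hgex x₀
    exact ⟨x, hx.congr_field fun t ht => hgf _ (hVr g hgdec x hx (hx0 ▸ hx₀) t ht), hx0⟩
  refine ⟨?_, hstable, ?_⟩
  · obtain ⟨r, hr, -, hrmin, V, hV, hxsV, hVr⟩ := key Set.univ Filter.univ_mem
    obtain ⟨V', hV', hV'ex⟩ := hstable V hV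
    obtain ⟨x, hx, hx0⟩ := (hV'ex xs (mem_of_mem_nhds hV')).1
    -- A motion starting at a strict minimum of a nonincreasing function cannot move, so the field
    -- vanishes there.
    have hconst : ∀ t ∈ Set.Ici (0 : ℝ), x t = xs := by
      intro t ht
      by_contra hne
      have h1 := hrmin _ (hVr f hdec x hx (hx0 ▸ hxsV) t ht) hne
      have h2 : W (x t) ≤ W (x 0) := hx.antitoneOn hW hdec Set.self_mem_Ici ht ht
      rw [hx0] at h2
      linarith
    have h1 := hx 0 le_rfl
    rw [hx0] at h1
    exact (uniqueDiffWithinAt_Ici (0 : ℝ)).eq_deriv _ h1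
      ((hasDerivWithinAt_const 0 _ xs).congr hconst hx0)
  · obtain ⟨N, hN, hNconv⟩ := hinv
    obtain ⟨r, hr, hrN, hrmin, V, hV, -, hVr⟩ := key N hN
    obtain ⟨g, K, hgK, hgdec, hgf, hgex⟩ := cut r hr
    refine ⟨V, hV, fun x hx hx0 => ?_⟩
    have hxball := hVr f hdec x hx hx0
    have hxg : IsSolution g x := hx.congr_field fun t ht => (hgf _ (hxball t ht)).symm
    have hev : ∀ᶠ t in Filter.atTop, x t ∈ Metric.closedBall xs r :=
      (Filter.eventually_ge_atTop 0).mono hxball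
    refine (isCompact_closedBall xs r).tendsto_nhds_of_unique_mapClusterPt hev fun z hz hzc => ?_
    have hmem : ∀ w, MapClusterPt w Filter.atTop x → w ∈ Metric.closedBall xs r := fun w hw =>
      Metric.isClosed_closedBall.mem_of_mapClusterPt hw hev
    -- `W ∘ x` converges
    have hWle : ∀ w ∈ Metric.closedBall xs r, W xs ≤ W w := fun w hw => by
      rcases eq_or_ne w xs with rfl | hne
      exacts [le_rfl, (hrmin w hw hne).le]
    have hanti : Antitone fun t : ℝ => W (x (max t 0)) := fun a b hab =>
      hx.antitoneOn hW hdec (Set.mem_Ici.2 (le_max_right _ _)) (Set.mem_Ici.2 (le_max_right _ _))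
        (max_le_max_right 0 hab)
    have hlim := tendsto_atTop_ciInf hanti
      ⟨W xs, by rintro _ ⟨t, rfl⟩; exact hWle _ (hxball _ (le_max_right _ _))⟩
    set ℓ := ⨅ t : ℝ, W (x (max t 0))
    have hlim' : Filter.Tendsto (W ∘ x) Filter.atTop (𝓝 ℓ) := hlim.congr' <|
      (Filter.eventually_ge_atTop 0).mono fun t ht => by simp [max_eq_left ht]
    have hWℓ : ∀ w, MapClusterPt w Filter.atTop x → W w = ℓ := fun w hw =>
      eq_of_nhds_neBot ((hw.tendsto_comp (hW.continuous.tendsto w)).clusterPt.mono hlim')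
    -- The motion from a limit point `z` stays in the limit set, where `W = ℓ`. Hence the derivative
    -- of `W` vanishes along it, it converges to `xs`, and `ℓ = W xs`; strictness of the minimum
    -- then forces `z = xs`.
    obtain ⟨y, hy, hy0⟩ := hgex z
    have hyc : ∀ t : ℝ, 0 ≤ t → MapClusterPt (y t) Filter.atTop x := fun t ht =>
      hxg.mapClusterPt hgK hy (hy0 ▸ hzc) ht
    have hyf : IsSolution f y := hy.congr_field fun t ht => hgf _ (hmem _ (hyc t ht))
    have hylim := hNconv y hyf (hrN (hmem _ (hyc 0 le_rfl))) fun t ht =>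
      ((uniqueDiffOn_Ici (0 : ℝ)) t ht).eq_deriv _ (hyf.hasDerivWithinAt_comp hW ht)
        ((hasDerivWithinAt_const t _ ℓ).congr (fun u hu => hWℓ _ (hyc u hu)) (hWℓ _ (hyc t ht)))
    have hxsℓ : W xs = ℓ := tendsto_nhds_unique ((hW.continuous.tendsto xs).comp hylim)
      (tendsto_const_nhds.congr' <| (Filter.eventually_ge_atTop 0).mono fun t ht =>
        (hWℓ _ (hyc t ht)).symm)
    by_contra hne
    have := hrmin z hz hne
    rw [hWℓ z hzc] at this
    linarith

end Dynamics

/-! ### Entrywise smoothness of matrix-valued maps. -/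

section Smoothness

variable {X Y : Type*} [NormedAddCommGroup X] [NormedSpace ℝ X] [NormedAddCommGroup Y]
  [NormedSpace ℝ Y] {ι κ μ : Type*} {k : WithTop ℕ∞}

/-- A matrix-valued map all of whose entries are `C^k`. -/
def ContDiffMatrix (k : WithTop ℕ∞) (A : X → Matrix ι κ ℝ) : Prop :=
  ∀ i j, ContDiff ℝ k fun x => A x i j

namespace ContDiffMatrix

variable {A B : X → Matrix ι κ ℝ}

theorem of_le {l : WithTop ℕ∞} (hA : ContDiffMatrix l A) (h : k ≤ l) : ContDiffMatrix k A :=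
  fun i j => (hA i j).of_le h

theorem const (A : Matrix ι κ ℝ) : ContDiffMatrix k fun _ : X => A := fun _ _ => contDiff_const

theorem comp {g : Y → X} (hA : ContDiffMatrix k A) (hg : ContDiff ℝ k g) :
    ContDiffMatrix k fun y => A (g y) := fun i j => (hA i j).comp hg

theorem add (hA : ContDiffMatrix k A) (hB : ContDiffMatrix k B) :
    ContDiffMatrix k fun x => A x + B x := fun i j => (hA i j).add (hB i j)

theorem sub (hA : ContDiffMatrix k A) (hB : ContDiffMatrix k B) :
    ContDiffMatrix k fun x => A x - B x := fun i j => (hA i j).sub (hB i j)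

theorem transpose (hA : ContDiffMatrix k A) : ContDiffMatrix k fun x => (A x)ᵀ :=
  fun i j => hA j i

theorem mul [Fintype κ] {C : X → Matrix κ μ ℝ} (hA : ContDiffMatrix k A)
    (hC : ContDiffMatrix k C) : ContDiffMatrix k fun x => A x * C x := by
  intro i j
  simp only [Matrix.mul_apply]
  exact ContDiff.sum fun l _ => (hA i l).mul (hC l j)

theorem fromRows {C : X → Matrix μ κ ℝ} (hA : ContDiffMatrix k A) (hC : ContDiffMatrix k C) :
    ContDiffMatrix k fun x => Matrix.fromRows (A x) (C x) := by
  rintro (i | i) j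
  exacts [hA i j, hC i j]

theorem fromCols {C : X → Matrix ι μ ℝ} (hA : ContDiffMatrix k A) (hC : ContDiffMatrix k C) :
    ContDiffMatrix k fun x => Matrix.fromCols (A x) (C x) := by
  rintro i (j | j)
  exacts [hA i j, hC i j]

theorem det [Fintype ι] [DecidableEq ι] {A : X → Matrix ι ι ℝ} (hA : ContDiffMatrix k A) :
    ContDiff ℝ k fun x => (A x).det := by
  simp only [Matrix.det_apply]
  exact ContDiff.sum fun σ _ => (contDiff_prod fun i _ => hA (σ i) i).const_smul _

/-- Cramer's rule: each entry is the reciprocal of a nonvanishing determinant times the determinant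
of the matrix with one row made constant. -/
theorem inv [Fintype ι] [DecidableEq ι] {A : X → Matrix ι ι ℝ} (hA : ContDiffMatrix k A)
    (h : ∀ x, IsUnit (A x)) : ContDiffMatrix k fun x => (A x)⁻¹ := by
  intro i j
  simp only [Matrix.inv_def, Ring.inverse_eq_inv', Matrix.smul_apply, smul_eq_mul,
    Matrix.adjugate_apply]
  refine (hA.det.inv fun x => ((Matrix.isUnit_iff_isUnit_det _).1 (h x)).ne_zero).mul (det ?_)
  intro a b
  simp only [Matrix.updateRow_apply]
  by_cases hab : a = j
  · simpa [hab] using contDiff_const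
  · simpa [hab] using hA a b

theorem mulVec [Fintype ι] [Fintype κ] {v : X → κ → ℝ} (hA : ContDiffMatrix k A)
    (hv : ContDiff ℝ k v) :
    ContDiff ℝ k fun x => A x *ᵥ v x :=
  contDiff_pi.2 fun i => ContDiff.sum fun j _ => (hA i j).mul (contDiff_pi.1 hv j)

end ContDiffMatrix

theorem contDiff_dotProduct [Fintype ι] {v w : X → ι → ℝ} (hv : ContDiff ℝ k v)
    (hw : ContDiff ℝ k w) : ContDiff ℝ k fun x => v x ⬝ᵥ w x :=
  ContDiff.sum fun i _ => (contDiff_pi.1 hv i).mul (contDiff_pi.1 hw i)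

theorem contDiff_sumElim [Fintype ι] [Fintype κ] {v : X → ι → ℝ} {w : X → κ → ℝ}
    (hv : ContDiff ℝ k v) (hw : ContDiff ℝ k w) :
    ContDiff ℝ k fun x => Sum.elim (v x) (w x) := by
  rw [contDiff_pi]
  rintro (i | i)
  exacts [contDiff_pi.1 hv i, contDiff_pi.1 hw i]

/-- Joint smoothness in the parameter and the variable is assumed because each partial gradient of
the energy must be smooth in the frozen variables too. -/
theorem contDiff_grad [Fintype ι] [DecidableEq ι] {l : WithTop ℕ∞} {F : X → (ι → ℝ) → ℝ}
    {g : X → ι → ℝ} (hF : ContDiff ℝ l (Function.uncurry F)) (hg : ContDiff ℝ k g)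
    (hkl : k + 1 ≤ l) : ContDiff ℝ k fun x => grad (F x) (g x) :=
  contDiff_pi.2 fun _ => (hF.fderiv hg hkl).clm_apply contDiff_const

end Smoothness

/-! ### The transformed energy and the regularity of the closed-loop field. -/

namespace MechSystem

variable {n m s : ℕ} (P : MechSystem n m) (Gp : (Fin n → ℝ) → Matrix (Fin s) (Fin n) ℝ)

theorem isUnit_M (q : Fin n → ℝ) : IsUnit (P.M q) := (P.M_posDef q).isUnit

theorem isUnit_Md (q : Fin n → ℝ) : IsUnit (P.Md q) := (P.Md_posDef q).isUnit

theorem isUnit_GtG (q : Fin n → ℝ) : IsUnit ((P.G q)ᵀ * P.G q) :=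
  isUnit_of_rank _ (by rw [Matrix.rank_transpose_mul_self, P.G_rank q])

theorem isUnit_mul_transpose_of_rank {A : Matrix (Fin s) (Fin n) ℝ} (h : A.rank = s) :
    IsUnit (A * Aᵀ) :=
  isUnit_of_rank _ (by rw [Matrix.rank_self_mul_transpose, h])

/-- `Gp` is a `C²` full-rank left annihilator of the input matrix. -/
structure IsAnnihilator : Prop where
  contDiff : ContDiffMatrix 2 Gp
  rank_eq : ∀ q, (Gp q).rank = s
  mul_G : ∀ q, Gp q * P.G q = 0

variable {P Gp} {X : Type*} [NormedAddCommGroup X] [NormedSpace ℝ X]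

theorem contDiff_H {q p : X → Fin n → ℝ} (hq : ContDiff ℝ 2 q) (hp : ContDiff ℝ 2 p) :
    ContDiff ℝ 2 fun x => P.H (q x) (p x) := by
  have h : ContDiffMatrix 2 fun x => (P.Md (q x))⁻¹ :=
    (ContDiffMatrix.inv P.Md_contDiff P.isUnit_Md).comp hq
  exact (contDiff_const.mul (contDiff_dotProduct hp (h.mulVec hp))).add (P.Vd_contDiff.comp hq)

theorem contDiff_Gdag : ContDiffMatrix 2 P.Gdag :=
  (ContDiffMatrix.inv ((ContDiffMatrix.transpose P.G_contDiff).mul P.G_contDiff) P.isUnit_GtG).mul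
    (ContDiffMatrix.transpose P.G_contDiff)

theorem contDiff_S1 : ContDiffMatrix 1 P.S1 := by
  have hG : ContDiffMatrix 2 P.G := P.G_contDiff
  exact (((ContDiffMatrix.inv P.M_contDiff P.isUnit_M).mul
    (ContDiffMatrix.of_le P.Md_contDiff one_le_two)).mul (hG.of_le one_le_two)).mul
    ((hG.transpose.mul hG).inv P.isUnit_GtG |>.of_le one_le_two)

namespace IsAnnihilator

variable (hG : P.IsAnnihilator Gp)
include hG

theorem contDiff_Tinv : ContDiffMatrix 2 (P.Tinv Gp) :=
  ContDiffMatrix.fromCols P.G_contDiff (hG.contDiff.transpose.mul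
    ((hG.contDiff.mul hG.contDiff.transpose).inv
      fun q => isUnit_mul_transpose_of_rank (hG.rank_eq q)))

theorem contDiff_T : ContDiffMatrix 2 (P.T Gp) := contDiff_Gdag.fromRows hG.contDiff

theorem T_mul_Tinv (q : Fin n → ℝ) : P.T Gp q * P.Tinv Gp q = 1 :=
  P.T_mul_Tinv Gp hG.rank_eq hG.mul_G q

theorem Tinv_mul_T (hns : m + s = n) (q : Fin n → ℝ) : P.Tinv Gp q * P.T Gp q = 1 :=
  P.Tinv_mul_T Gp hns hG.rank_eq hG.mul_G q

/-- Since `m + s = n`, the matrix `T` is square and its right inverse is two-sided, so the inverse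
of the product can be taken factor by factor. -/
theorem MdT_inv (hns : m + s = n) (q : Fin n → ℝ) :
    (P.MdT Gp q)⁻¹ = (P.Tinv Gp q)ᵀ * (P.Md q)⁻¹ * P.Tinv Gp q := by
  refine Matrix.inv_eq_right_inv ?_
  have h1 : (P.T Gp q)ᵀ * (P.Tinv Gp q)ᵀ = 1 := by
    rw [← Matrix.transpose_mul, hG.Tinv_mul_T hns, Matrix.transpose_one]
  have h2 := Matrix.mul_nonsing_inv _ ((Matrix.isUnit_iff_isUnit_det _).1 (P.isUnit_Md q))
  calc P.MdT Gp q * ((P.Tinv Gp q)ᵀ * (P.Md q)⁻¹ * P.Tinv Gp q)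
      = P.T Gp q * P.Md q * ((P.T Gp q)ᵀ * (P.Tinv Gp q)ᵀ) * (P.Md q)⁻¹ * P.Tinv Gp q := by
        simp only [MdT, Matrix.mul_assoc]
    _ = 1 := by rw [h1, Matrix.mul_one, Matrix.mul_assoc (P.T Gp q), h2, Matrix.mul_one,
        hG.T_mul_Tinv]

/-- The Hamiltonian in the new momenta is the original Hamiltonian in the new coordinates. -/
theorem HT_eq_H (hns : m + s = n) (q : Fin n → ℝ) (p₁ : Fin m → ℝ) (p₂ : Fin s → ℝ) :
    P.HT Gp q p₁ p₂ = P.H q (P.Tinv Gp q *ᵥ Sum.elim p₁ p₂) := by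
  rw [HT, H, hamiltonian, hG.MdT_inv hns, ← Matrix.mulVec_mulVec, ← Matrix.mulVec_mulVec,
    Matrix.dotProduct_mulVec _ (P.Tinv Gp q)ᵀ, Matrix.vecMul_transpose]

theorem contDiff_HT (hns : m + s = n) {q : X → Fin n → ℝ} {p₁ : X → Fin m → ℝ}
    {p₂ : X → Fin s → ℝ} (hq : ContDiff ℝ 2 q) (h₁ : ContDiff ℝ 2 p₁) (h₂ : ContDiff ℝ 2 p₂) :
    ContDiff ℝ 2 fun x => P.HT Gp (q x) (p₁ x) (p₂ x) := by
  simp only [hG.HT_eq_H hns]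
  exact contDiff_H hq ((hG.contDiff_Tinv.comp hq).mulVec (contDiff_sumElim h₁ h₂))

omit hG in
theorem contDiff_Hc (KI : Matrix (Fin m) (Fin m) ℝ) {k : WithTop ℕ∞} {p₁ ζ : X → Fin m → ℝ}
    (h₁ : ContDiff ℝ k p₁) (hζ : ContDiff ℝ k ζ) : ContDiff ℝ k fun x => Hc KI (p₁ x) (ζ x) :=
  contDiff_const.mul (contDiff_dotProduct (h₁.sub hζ)
    ((ContDiffMatrix.const KI).mulVec (h₁.sub hζ)))

theorem contDiff_Hcl (hns : m + s = n) (KI : Matrix (Fin m) (Fin m) ℝ) {q : X → Fin n → ℝ}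
    {p₁ ζ : X → Fin m → ℝ} {p₂ : X → Fin s → ℝ} (hq : ContDiff ℝ 2 q) (h₁ : ContDiff ℝ 2 p₁)
    (h₂ : ContDiff ℝ 2 p₂) (hζ : ContDiff ℝ 2 ζ) :
    ContDiff ℝ 2 fun x => P.Hcl Gp KI (q x) (p₁ x) (p₂ x) (ζ x) :=
  (hG.contDiff_HT hns hq h₁ h₂).add (contDiff_Hc KI h₁ hζ)

theorem contDiff_S2 : ContDiffMatrix 1 (P.S2 Gp) :=
  ((ContDiffMatrix.inv P.M_contDiff P.isUnit_M).mul
    (ContDiffMatrix.of_le P.Md_contDiff one_le_two)).mul (hG.contDiff.of_le one_le_two).transpose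

/-- The matrix `B` contains first derivatives of `Tinv`; the second derivative assumed of `G` and
`Gp` is spent here. -/
theorem contDiff_Jp {q : X → Fin n → ℝ} {p₁ : X → Fin m → ℝ} {p₂ : X → Fin s → ℝ}
    (hq : ContDiff ℝ 1 q) (h₁ : ContDiff ℝ 1 p₁) (h₂ : ContDiff ℝ 1 p₂) :
    ContDiffMatrix 1 fun x => P.Jp Gp (q x) (p₁ x) (p₂ x) := by
  have hB : ContDiffMatrix 1 fun y : (Fin n → ℝ) × (Fin m ⊕ Fin s → ℝ) =>
      jacobian (fun q' => P.Tinv Gp q' *ᵥ y.2) y.1 := fun i j =>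
    contDiff_pi.1 (contDiff_grad (l := 2)
      (F := fun (y : (Fin n → ℝ) × (Fin m ⊕ Fin s → ℝ)) q' => (P.Tinv Gp q' *ᵥ y.2) i)
      (contDiff_pi.1 ((hG.contDiff_Tinv.comp contDiff_snd).mulVec
        (contDiff_snd.comp contDiff_fst)) i) contDiff_fst (by norm_num)) j
  have hp := contDiff_sumElim h₁ h₂
  have hMi : ContDiffMatrix 1 fun x => (P.M (q x))⁻¹ :=
    (ContDiffMatrix.inv P.M_contDiff P.isUnit_M).comp hq
  have hMd : ContDiffMatrix 1 fun x => P.Md (q x) :=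
    (ContDiffMatrix.of_le P.Md_contDiff one_le_two).comp hq
  have hJ : ContDiffMatrix 1 fun x : (Fin n → ℝ) × (Fin n → ℝ) => P.J2 x.1 x.2 := P.J2_contDiff
  have hB' := hB.comp (hq.prodMk hp)
  exact (((hMd.mul hMi).mul hB'.transpose).sub ((hB'.mul hMi).mul hMd)).add (hJ.comp
    (hq.prodMk (((hG.contDiff_Tinv.of_le one_le_two).comp hq).mulVec hp)))

theorem contDiff_S32 {q : X → Fin n → ℝ} {p₁ : X → Fin m → ℝ} {p₂ : X → Fin s → ℝ}
    (hq : ContDiff ℝ 1 q) (h₁ : ContDiff ℝ 1 p₁) (h₂ : ContDiff ℝ 1 p₂) :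
    ContDiffMatrix 1 fun x => P.S32 Gp (q x) (p₁ x) (p₂ x) :=
  (((contDiff_Gdag.of_le one_le_two).comp hq).mul (hG.contDiff_Jp hq h₁ h₂)).mul
    ((hG.contDiff.of_le one_le_two).comp hq).transpose

theorem contDiff_S34 {q : X → Fin n → ℝ} {p₁ : X → Fin m → ℝ} {p₂ : X → Fin s → ℝ}
    (hq : ContDiff ℝ 1 q) (h₁ : ContDiff ℝ 1 p₁) (h₂ : ContDiff ℝ 1 p₂) :
    ContDiffMatrix 1 fun x => P.S34 Gp (q x) (p₁ x) (p₂ x) :=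
  (((hG.contDiff.of_le one_le_two).comp hq).mul (hG.contDiff_Jp hq h₁ h₂)).mul
    ((hG.contDiff.of_le one_le_two).comp hq).transpose

theorem contDiff_closedLoop (hns : m + s = n) (KI Jc1 Rc1 Rc2 : Matrix (Fin m) (Fin m) ℝ)
    (d : Fin m → ℝ) : ContDiff ℝ 1 (P.closedLoop Gp KI Jc1 Rc1 Rc2 d) := by
  let St := (Fin n → ℝ) × (Fin m → ℝ) × (Fin s → ℝ) × (Fin m → ℝ)
  have hq : ∀ {k}, ContDiff ℝ k fun x : St => x.1 := contDiff_fst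
  have h₁ : ∀ {k}, ContDiff ℝ k fun x : St => x.2.1 := contDiff_fst.comp contDiff_snd
  have h₂ : ∀ {k}, ContDiff ℝ k fun x : St => x.2.2.1 :=
    contDiff_fst.comp (contDiff_snd.comp contDiff_snd)
  have hζ : ∀ {k}, ContDiff ℝ k fun x : St => x.2.2.2 :=
    contDiff_snd.comp (contDiff_snd.comp contDiff_snd)
  have h12 : (1 : WithTop ℕ∞) + 1 ≤ 2 := by norm_num
  have gq : ContDiff ℝ 1 fun x : St =>
      grad (fun q' => P.Hcl Gp KI q' x.2.1 x.2.2.1 x.2.2.2) x.1 :=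
    contDiff_grad (hG.contDiff_Hcl hns KI contDiff_snd (h₁.comp contDiff_fst)
      (h₂.comp contDiff_fst) (hζ.comp contDiff_fst)) hq h12
  have g₁ : ContDiff ℝ 1 fun x : St =>
      grad (fun p' => P.Hcl Gp KI x.1 p' x.2.2.1 x.2.2.2) x.2.1 :=
    contDiff_grad (hG.contDiff_Hcl hns KI (hq.comp contDiff_fst) contDiff_snd
      (h₂.comp contDiff_fst) (hζ.comp contDiff_fst)) h₁ h12
  have g₂ : ContDiff ℝ 1 fun x : St =>
      grad (fun p' => P.Hcl Gp KI x.1 x.2.1 p' x.2.2.2) x.2.2.1 :=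
    contDiff_grad (hG.contDiff_Hcl hns KI (hq.comp contDiff_fst) (h₁.comp contDiff_fst)
      contDiff_snd (hζ.comp contDiff_fst)) h₂ h12
  have gζ : ContDiff ℝ 1 fun x : St =>
      grad (fun ζ' => P.Hcl Gp KI x.1 x.2.1 x.2.2.1 ζ') x.2.2.2 :=
    contDiff_grad (hG.contDiff_Hcl hns KI (hq.comp contDiff_fst) (h₁.comp contDiff_fst)
      (h₂.comp contDiff_fst) contDiff_snd) hζ h12
  have s1 : ContDiffMatrix 1 fun x : St => P.S1 x.1 := contDiff_S1.comp hq
  have s2 : ContDiffMatrix 1 fun x : St => P.S2 Gp x.1 := hG.contDiff_S2.comp hq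
  have s32 : ContDiffMatrix 1 fun x : St => P.S32 Gp x.1 x.2.1 x.2.2.1 :=
    hG.contDiff_S32 hq h₁ h₂
  have s34 : ContDiffMatrix 1 fun x : St => P.S34 Gp x.1 x.2.1 x.2.2.1 :=
    hG.contDiff_S34 hq h₁ h₂
  have cm : ∀ A : Matrix (Fin m) (Fin m) ℝ, ContDiffMatrix 1 fun _ : St => A :=
    ContDiffMatrix.const
  exact ((s1.mulVec g₁).add (s2.mulVec g₂) |>.add (s1.mulVec gζ)).prodMk <|
    ((s1.transpose.mulVec gq).neg.add ((cm _).mulVec g₁) |>.add (s32.mulVec g₂)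
      |>.sub ((cm _).mulVec gζ) |>.sub contDiff_const).prodMk <|
    ((s2.transpose.mulVec gq).neg.sub (s32.transpose.mulVec g₁) |>.add (s34.mulVec g₂)
      |>.sub (s32.transpose.mulVec gζ)).prodMk <|
    (s1.transpose.mulVec gq).neg.sub ((cm _).mulVec g₁) |>.add (s32.mulVec g₂)
      |>.sub ((cm _).mulVec gζ)

end IsAnnihilator
end MechSystem

/-! ### Partial derivatives, gradients and Jacobians. -/

section Calculus

variable {A B F : Type*} [NormedAddCommGroup A] [NormedSpace ℝ A] [NormedAddCommGroup B]
  [NormedSpace ℝ B] [NormedAddCommGroup F] [NormedSpace ℝ F]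
  {ι κ : Type*} [Fintype ι] [DecidableEq ι]

/-- The derivative on a product is the sum of the partial derivatives. -/
theorem fderiv_prod_apply {f : A × B → F} {x : A × B} (hf : DifferentiableAt ℝ f x) (v : A × B) :
    fderiv ℝ f x v =
      fderiv ℝ (fun a => f (a, x.2)) x.1 v.1 + fderiv ℝ (fun b => f (x.1, b)) x.2 v.2 := by
  have h1 : HasFDerivAt (fun a => f (a, x.2)) _ x.1 :=
    hf.hasFDerivAt.comp x.1 (hasFDerivAt_prodMk_left x.1 x.2)
  have h2 : HasFDerivAt (fun b => f (x.1, b)) _ x.2 :=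
    hf.hasFDerivAt.comp x.2 (hasFDerivAt_prodMk_right x.1 x.2)
  rw [h1.fderiv, h2.fderiv]
  simp [← map_add]

theorem fderiv_eq_grad_dotProduct (f : (ι → ℝ) → ℝ) (x v : ι → ℝ) :
    fderiv ℝ f x v = grad f x ⬝ᵥ v := by
  conv_lhs => rw [pi_eq_sum_univ' v]
  simp only [map_sum, map_smul, smul_eq_mul, dotProduct, grad]
  exact Finset.sum_congr rfl fun i _ => mul_comm _ _

theorem grad_eq_of_forall {f : (ι → ℝ) → ℝ} {x g : ι → ℝ}
    (h : ∀ v, fderiv ℝ f x v = g ⬝ᵥ v) : grad f x = g := by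
  funext i
  simp [grad, h]

theorem fderiv_eq_jacobian_mulVec [Fintype κ] {f : (ι → ℝ) → κ → ℝ} {x : ι → ℝ}
    (hf : DifferentiableAt ℝ f x) (v : ι → ℝ) : fderiv ℝ f x v = jacobian f x *ᵥ v := by
  funext i
  have h := (hasFDerivAt_pi'.1 hf.hasFDerivAt i).fderiv
  change _ = grad (fun x' => f x' i) x ⬝ᵥ v
  rw [← fderiv_eq_grad_dotProduct, h]
  rfl

omit [DecidableEq ι] in
theorem fderiv_mulVec [Fintype κ] (M : Matrix κ ι ℝ) (x v : ι → ℝ) :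
    fderiv ℝ (fun y => M *ᵥ y) x v = M *ᵥ v := by
  have h : HasFDerivAt (fun y => M *ᵥ y) (LinearMap.toContinuousLinearMap M.mulVecLin) x :=
    (LinearMap.toContinuousLinearMap M.mulVecLin).hasFDerivAt
  rw [h.fderiv]
  rfl

omit [DecidableEq ι] in
-- Along a line the form is a quadratic polynomial in `t`; symmetry merges the two cross terms,
-- which cancels the factor one half.
theorem fderiv_half_quadratic {K : Matrix ι ι ℝ} (hK : Kᵀ = K) (x v : ι → ℝ) :
    fderiv ℝ (fun y => (1 / 2 : ℝ) * (y ⬝ᵥ (K *ᵥ y))) x v = (K *ᵥ x) ⬝ᵥ v := by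
  have hd : DifferentiableAt ℝ (fun y : ι → ℝ => (1 / 2 : ℝ) * (y ⬝ᵥ (K *ᵥ y))) x :=
    ((contDiff_const (n := 1)).mul (contDiff_dotProduct contDiff_id
      ((ContDiffMatrix.const K).mulVec contDiff_id))).differentiable one_ne_zero x
  rw [← hd.lineDeriv_eq_fderiv, lineDeriv]
  have hs : v ⬝ᵥ (K *ᵥ x) = x ⬝ᵥ (K *ᵥ v) := by
    rw [Matrix.dotProduct_mulVec x, ← Matrix.mulVec_transpose, hK, dotProduct_comm]
  have h : (fun t : ℝ => (1 / 2 : ℝ) * ((x + t • v) ⬝ᵥ (K *ᵥ (x + t • v)))) = fun t =>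
      (1 / 2 : ℝ) * (x ⬝ᵥ (K *ᵥ x)) + t * (x ⬝ᵥ (K *ᵥ v)) + t ^ 2 * ((1 / 2) * (v ⬝ᵥ (K *ᵥ v))) := by
    funext t
    simp only [Matrix.mulVec_add, Matrix.mulVec_smul, dotProduct_add, add_dotProduct,
      smul_dotProduct, dotProduct_smul, smul_eq_mul, hs]
    ring
  have hder := ((hasDerivAt_id (0 : ℝ)).mul_const (x ⬝ᵥ (K *ᵥ v))).const_add
    ((1 / 2 : ℝ) * (x ⬝ᵥ (K *ᵥ x))) |>.add
    (((hasDerivAt_id (0 : ℝ)).pow 2).mul_const ((1 / 2) * (v ⬝ᵥ (K *ᵥ v))))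
  rw [h]
  refine Eq.trans (HasDerivAt.deriv hder) ?_
  simp [← hs, dotProduct_comm]

end Calculus

/-! ### Skew and positive definite matrices, and the power balance. -/

section LinearAlgebra

variable {ι : Type*} [Fintype ι]

theorem dotProduct_mulVec_self_of_skew {J : Matrix ι ι ℝ} (hJ : Jᵀ = -J) (v : ι → ℝ) :
    v ⬝ᵥ (J *ᵥ v) = 0 := by
  have h : v ⬝ᵥ (J *ᵥ v) = v ⬝ᵥ (Jᵀ *ᵥ v) := by
    rw [Matrix.dotProduct_mulVec, Matrix.mulVec_transpose, dotProduct_comm]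
  rw [hJ, Matrix.neg_mulVec, dotProduct_neg] at h
  linarith

theorem posDef_dotProduct_eq_zero_iff {R : Matrix ι ι ℝ} (hR : R.PosDef) {v : ι → ℝ} :
    v ⬝ᵥ (R *ᵥ v) = 0 ↔ v = 0 := by
  refine ⟨fun h => ?_, fun h => by simp [h]⟩
  by_contra hv
  have := hR.dotProduct_mulVec_pos hv
  simp only [star_trivial] at this
  exact this.ne' h

theorem posDef_dotProduct_nonneg {R : Matrix ι ι ℝ} (hR : R.PosDef) (v : ι → ℝ) :
    0 ≤ v ⬝ᵥ (R *ᵥ v) := by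
  simpa using hR.posSemidef.dotProduct_mulVec_nonneg v

/-- A kernel vector satisfies `J v = R v`; pairing with `v` kills the skew side, so positive
definiteness gives `v = 0`. This makes the equilibrium value of ζ meaningful. -/
theorem isUnit_skew_sub_posDef [DecidableEq ι] {J R : Matrix ι ι ℝ} (hJ : Jᵀ = -J) (hR : R.PosDef) :
    IsUnit (J - R) := by
  rw [← Matrix.mulVec_injective_iff_isUnit]
  refine (injective_iff_map_eq_zero (J - R).mulVecLin).2 fun v hv => ?_
  rw [Matrix.mulVecLin_apply, Matrix.sub_mulVec, sub_eq_zero] at hv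
  rw [← posDef_dotProduct_eq_zero_iff hR, ← hv, dotProduct_mulVec_self_of_skew hJ]

end LinearAlgebra

/-- Power balance of the closed loop: `a`, `g`, `b` are the partial gradients of the mechanical
energy, `w` is the shifted controller force and `c` its offset. -/
theorem power_balance {n m s : ℕ} (S₁ : Matrix (Fin n) (Fin m) ℝ) (S₂ : Matrix (Fin n) (Fin s) ℝ)
    (S₃₂ : Matrix (Fin m) (Fin s) ℝ) {S₃₄ : Matrix (Fin s) (Fin s) ℝ}
    {J : Matrix (Fin m) (Fin m) ℝ} (h34 : S₃₄ᵀ = -S₃₄) (hJ : Jᵀ = -J)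
    (R₁ R₂ : Matrix (Fin m) (Fin m) ℝ)
    (g : Fin n → ℝ) (a w c : Fin m → ℝ) (b : Fin s → ℝ) :
    g ⬝ᵥ (S₁ *ᵥ (a + (w + c)) + S₂ *ᵥ b + S₁ *ᵥ (-(w + c))) +
      (a ⬝ᵥ (-(S₁ᵀ *ᵥ g) + (J - R₁ - R₂) *ᵥ (a + (w + c)) + S₃₂ *ᵥ b - R₂ *ᵥ (-(w + c))
        - (J - R₁) *ᵥ c) +
      b ⬝ᵥ (-(S₂ᵀ *ᵥ g) - S₃₂ᵀ *ᵥ (a + (w + c)) + S₃₄ *ᵥ b - S₃₂ᵀ *ᵥ (-(w + c)))) +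
      w ⬝ᵥ ((-(S₁ᵀ *ᵥ g) + (J - R₁ - R₂) *ᵥ (a + (w + c)) + S₃₂ *ᵥ b - R₂ *ᵥ (-(w + c))
        - (J - R₁) *ᵥ c) -
        (-(S₁ᵀ *ᵥ g) - R₂ *ᵥ (a + (w + c)) + S₃₂ *ᵥ b - R₂ *ᵥ (-(w + c)))) =
      -((a + w) ⬝ᵥ (R₁ *ᵥ (a + w))) - a ⬝ᵥ (R₂ *ᵥ a) := by
  -- The offset `c` cancels, and the last bracket, the rate of `p₁` minus that of ζ, is `(J - R₁)(a
  -- + w)`. Each coupling block then meets its transpose with the opposite sign, and the skew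
  -- diagonal terms contribute nothing.
  have h1 : a ⬝ᵥ (S₁ᵀ *ᵥ g) = g ⬝ᵥ (S₁ *ᵥ a) := by
    rw [Matrix.dotProduct_mulVec g, Matrix.mulVec_transpose, dotProduct_comm]
  have h2 : b ⬝ᵥ (S₂ᵀ *ᵥ g) = g ⬝ᵥ (S₂ *ᵥ b) := by
    rw [Matrix.dotProduct_mulVec g, Matrix.mulVec_transpose, dotProduct_comm]
  have h3 : b ⬝ᵥ (S₃₂ᵀ *ᵥ a) = a ⬝ᵥ (S₃₂ *ᵥ b) := by
    rw [Matrix.dotProduct_mulVec a, Matrix.mulVec_transpose, dotProduct_comm]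
  have h4 := dotProduct_mulVec_self_of_skew h34 b
  have h5 := dotProduct_mulVec_self_of_skew hJ (a + w)
  simp only [Matrix.mulVec_add, Matrix.sub_mulVec, Matrix.mulVec_neg, dotProduct_add,
    dotProduct_sub, dotProduct_neg, add_dotProduct] at h5 ⊢
  linarith

/-! ### Gradients of the closed-loop energy and its dissipation. -/

namespace MechSystem

variable {n m s : ℕ} {P : MechSystem n m} {Gp : (Fin n → ℝ) → Matrix (Fin s) (Fin n) ℝ}
  {KI Jc1 Rc1 Rc2 : Matrix (Fin m) (Fin m) ℝ} {d : Fin m → ℝ}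

/-- The first two terms are transposes of each other with opposite signs, as `M` and `Md` are
symmetric; `J2` is skew by assumption. -/
theorem transpose_Jp (q : Fin n → ℝ) (p₁ : Fin m → ℝ) (p₂ : Fin s → ℝ) :
    (P.Jp Gp q p₁ p₂)ᵀ = -P.Jp Gp q p₁ p₂ := by
  have hM : (P.M q)ᵀ = P.M q := by simpa using (P.M_posDef q).isHermitian.eq
  have hMd : (P.Md q)ᵀ = P.Md q := by simpa using (P.Md_posDef q).isHermitian.eq
  simp only [Jp, Matrix.transpose_add, Matrix.transpose_sub, Matrix.transpose_mul,
    Matrix.transpose_transpose, Matrix.transpose_nonsing_inv, hM, hMd, P.J2_skew, Matrix.mul_assoc]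
  abel

theorem transpose_S34 (q : Fin n → ℝ) (p₁ : Fin m → ℝ) (p₂ : Fin s → ℝ) :
    (P.S34 Gp q p₁ p₂)ᵀ = -P.S34 Gp q p₁ p₂ := by
  simp only [S34, Matrix.transpose_mul, Matrix.transpose_transpose, transpose_Jp,
    Matrix.mul_neg, Matrix.neg_mul, Matrix.mul_assoc]

/-- Both arguments vary with `x`, so one chain rule serves the gradients in `p₁` and in ζ as well as
the shifted energy. -/
theorem fderiv_Hc {X : Type*} [NormedAddCommGroup X] [NormedSpace ℝ X] (hKI : KIᵀ = KI)
    {p ζ : X → Fin m → ℝ} {p' ζ' : X →L[ℝ] Fin m → ℝ} {x : X} (hp : HasFDerivAt p p' x)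
    (hζ : HasFDerivAt ζ ζ' x) (v : X) :
    fderiv ℝ (fun y => Hc KI (p y) (ζ y)) x v = (KI *ᵥ (p x - ζ x)) ⬝ᵥ (p' v - ζ' v) := by
  have hd : DifferentiableAt ℝ (fun y : Fin m → ℝ => (1 / 2 : ℝ) * (y ⬝ᵥ (KI *ᵥ y)))
      (p x - ζ x) :=
    ((contDiff_const (n := 1)).mul (contDiff_dotProduct contDiff_id
      ((ContDiffMatrix.const KI).mulVec contDiff_id))).differentiable one_ne_zero _
  have h : HasFDerivAt (fun y => Hc KI (p y) (ζ y)) _ x :=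
    HasFDerivAt.comp (g := fun y : Fin m → ℝ => (1 / 2 : ℝ) * (y ⬝ᵥ (KI *ᵥ y)))
      (f := fun y => p y - ζ y) x hd.hasFDerivAt (hp.sub hζ)
  rw [h.fderiv, ContinuousLinearMap.comp_apply, fderiv_half_quadratic hKI]
  rfl

namespace IsAnnihilator

variable (hG : P.IsAnnihilator Gp) (hns : m + s = n) (hKI : KIᵀ = KI)
include hG hns

theorem differentiable_HT {X : Type*} [NormedAddCommGroup X] [NormedSpace ℝ X]
    {q : X → Fin n → ℝ} {p₁ : X → Fin m → ℝ}
    {p₂ : X → Fin s → ℝ} (hq : ContDiff ℝ 2 q) (h₁ : ContDiff ℝ 2 p₁) (h₂ : ContDiff ℝ 2 p₂) :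
    Differentiable ℝ fun x => P.HT Gp (q x) (p₁ x) (p₂ x) :=
  (hG.contDiff_HT hns hq h₁ h₂).differentiable two_ne_zero

omit hG hns in
theorem differentiable_Hc {X : Type*} [NormedAddCommGroup X] [NormedSpace ℝ X]
    (KI : Matrix (Fin m) (Fin m) ℝ)
    {p ζ : X → Fin m → ℝ} (hp : ContDiff ℝ 1 p) (hζ : ContDiff ℝ 1 ζ) :
    Differentiable ℝ fun x => Hc KI (p x) (ζ x) :=
  (contDiff_Hc KI hp hζ).differentiable one_ne_zero

omit hG hns in
theorem grad_Hcl_q (q : Fin n → ℝ) (p₁ : Fin m → ℝ) (p₂ : Fin s → ℝ) (ζ : Fin m → ℝ) :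
    grad (fun q' => P.Hcl Gp KI q' p₁ p₂ ζ) q = grad (fun q' => P.HT Gp q' p₁ p₂) q := by
  funext i
  simp only [grad, Hcl, fderiv_add_const]

omit hG hns in
theorem grad_Hcl_p₂ (q : Fin n → ℝ) (p₁ : Fin m → ℝ) (p₂ : Fin s → ℝ) (ζ : Fin m → ℝ) :
    grad (fun p' => P.Hcl Gp KI q p₁ p' ζ) p₂ = grad (fun p' => P.HT Gp q p₁ p') p₂ := by
  funext i
  simp only [grad, Hcl, fderiv_add_const]

include hKI

omit hG hns in
theorem grad_Hcl_ζ (q : Fin n → ℝ) (p₁ : Fin m → ℝ) (p₂ : Fin s → ℝ) (ζ : Fin m → ℝ) :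
    grad (fun ζ' => P.Hcl Gp KI q p₁ p₂ ζ') ζ = -(KI *ᵥ (p₁ - ζ)) := by
  refine grad_eq_of_forall fun v => ?_
  simp only [Hcl, fderiv_const_add]
  have h := fderiv_Hc hKI (ζ := fun y => y) (hasFDerivAt_const p₁ ζ) (hasFDerivAt_id ζ) v
  refine h.trans ?_
  simp

theorem grad_Hcl_p₁ (q : Fin n → ℝ) (p₁ : Fin m → ℝ) (p₂ : Fin s → ℝ) (ζ : Fin m → ℝ) :
    grad (fun p' => P.Hcl Gp KI q p' p₂ ζ) p₁ =
      grad (fun p' => P.HT Gp q p' p₂) p₁ + KI *ᵥ (p₁ - ζ) := by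
  refine grad_eq_of_forall fun v => ?_
  have h1 : DifferentiableAt ℝ (fun p' => P.HT Gp q p' p₂) p₁ :=
    hG.differentiable_HT hns contDiff_const contDiff_id contDiff_const p₁
  have h2 : DifferentiableAt ℝ (fun p' => Hc KI p' ζ) p₁ :=
    differentiable_Hc KI contDiff_id contDiff_const p₁
  have h3 := fderiv_Hc hKI (p := fun y => y) (hasFDerivAt_id p₁) (hasFDerivAt_const ζ p₁) v
  simp only [Hcl]
  rw [fderiv_fun_add h1 h2, add_apply, h3, fderiv_eq_grad_dotProduct,
    add_dotProduct]
  simp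

end IsAnnihilator

/-- The closed-loop energy with the controller energy centred at the equilibrium. -/
def lyapunov (P : MechSystem n m) (Gp : (Fin n → ℝ) → Matrix (Fin s) (Fin n) ℝ)
    (KI : Matrix (Fin m) (Fin m) ℝ) (c : Fin m → ℝ)
    (x : (Fin n → ℝ) × (Fin m → ℝ) × (Fin s → ℝ) × (Fin m → ℝ)) : ℝ :=
  P.HT Gp x.1 x.2.1 x.2.2.1 + Hc KI (x.2.1 - c) x.2.2.2

namespace IsAnnihilator

variable (hG : P.IsAnnihilator Gp) (hns : m + s = n) (hKI : KIᵀ = KI)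
include hG hns

theorem differentiable_lyapunov (KI : Matrix (Fin m) (Fin m) ℝ) (c : Fin m → ℝ) :
    Differentiable ℝ (P.lyapunov Gp KI c) :=
  (hG.differentiable_HT hns contDiff_fst (contDiff_fst.comp contDiff_snd)
    (contDiff_fst.comp (contDiff_snd.comp contDiff_snd))).add
  (differentiable_Hc KI ((contDiff_fst.comp contDiff_snd).sub contDiff_const)
    (contDiff_snd.comp (contDiff_snd.comp contDiff_snd)))

include hKI

theorem fderiv_lyapunov (c : Fin m → ℝ)
    (x v : (Fin n → ℝ) × (Fin m → ℝ) × (Fin s → ℝ) × (Fin m → ℝ)) :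
    fderiv ℝ (P.lyapunov Gp KI c) x v =
      grad (fun q' => P.HT Gp q' x.2.1 x.2.2.1) x.1 ⬝ᵥ v.1 +
      (grad (fun p' => P.HT Gp x.1 p' x.2.2.1) x.2.1 ⬝ᵥ v.2.1 +
      grad (fun p' => P.HT Gp x.1 x.2.1 p') x.2.2.1 ⬝ᵥ v.2.2.1) +
      (KI *ᵥ (x.2.1 - c - x.2.2.2)) ⬝ᵥ (v.2.1 - v.2.2.2) := by
  have h1 : Differentiable ℝ fun y : (Fin n → ℝ) × (Fin m → ℝ) × (Fin s → ℝ) × (Fin m → ℝ) =>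
      P.HT Gp y.1 y.2.1 y.2.2.1 :=
    hG.differentiable_HT hns contDiff_fst (contDiff_fst.comp contDiff_snd)
      (contDiff_fst.comp (contDiff_snd.comp contDiff_snd))
  have h2 : Differentiable ℝ fun y : (Fin m → ℝ) × (Fin s → ℝ) × (Fin m → ℝ) =>
      P.HT Gp x.1 y.1 y.2.1 :=
    hG.differentiable_HT hns contDiff_const contDiff_fst (contDiff_fst.comp contDiff_snd)
  have h3 : Differentiable ℝ fun y : (Fin s → ℝ) × (Fin m → ℝ) => P.HT Gp x.1 x.2.1 y.1 :=
    hG.differentiable_HT hns contDiff_const contDiff_const contDiff_fst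
  have h4 : DifferentiableAt ℝ (fun y : (Fin n → ℝ) × (Fin m → ℝ) × (Fin s → ℝ) × (Fin m → ℝ) =>
      Hc KI (y.2.1 - c) y.2.2.2) x :=
    differentiable_Hc KI ((contDiff_fst.comp contDiff_snd).sub contDiff_const)
      (contDiff_snd.comp (contDiff_snd.comp contDiff_snd)) x
  have h5 := fderiv_Hc hKI (x := x) (p := fun y => y.2.1 - c) (ζ := fun y => y.2.2.2)
    ((hasFDerivAt_fst.comp x hasFDerivAt_snd).sub_const c)
    (hasFDerivAt_snd.comp x (hasFDerivAt_snd.comp x hasFDerivAt_snd)) v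
  have e : P.lyapunov Gp KI c = fun y => P.HT Gp y.1 y.2.1 y.2.2.1 + Hc KI (y.2.1 - c) y.2.2.2 :=
    rfl
  rw [e, fderiv_fun_add (h1 x) h4, add_apply, h5, fderiv_prod_apply (h1 x),
    fderiv_prod_apply (h2 x.2), fderiv_prod_apply (h3 x.2.2)]
  -- Three product splittings leave a ζ-derivative of the mechanical energy, which does not depend
  -- on ζ.
  have h0 : grad (fun _ : Fin m → ℝ => P.HT Gp x.1 x.2.1 x.2.2.1) x.2.2.2 = 0 := by
    funext i; simp [grad]
  simp only [fderiv_eq_grad_dotProduct, h0]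
  simp

/-- The controller force `KI (p₁ - ζ)` is `w + KI c`, and `hc` writes the disturbance as `(Jc1 -
Rc1) (KI c)`; this is the shape treated by `power_balance`, with offset `KI c`. -/
theorem fderiv_lyapunov_closedLoop (hJ : Jc1ᵀ = -Jc1) {c : Fin m → ℝ}
    (hc : (Jc1 - Rc1) *ᵥ (KI *ᵥ c) = d)
    (x : (Fin n → ℝ) × (Fin m → ℝ) × (Fin s → ℝ) × (Fin m → ℝ)) {a w : Fin m → ℝ}
    (ha : a = grad (fun p' => P.HT Gp x.1 p' x.2.2.1) x.2.1)
    (hw : w = KI *ᵥ (x.2.1 - c - x.2.2.2)) :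
    fderiv ℝ (P.lyapunov Gp KI c) x (P.closedLoop Gp KI Jc1 Rc1 Rc2 d x) =
      -((a + w) ⬝ᵥ (Rc1 *ᵥ (a + w))) - a ⬝ᵥ (Rc2 *ᵥ a) := by
  subst ha hw
  have hz : KI *ᵥ (x.2.1 - x.2.2.2) = KI *ᵥ (x.2.1 - c - x.2.2.2) + KI *ᵥ c := by
    rw [← Matrix.mulVec_add]; congr 1; abel
  rw [hG.fderiv_lyapunov hns hKI]
  simp only [closedLoop, grad_Hcl_q, grad_Hcl_p₂, grad_Hcl_ζ hKI, hG.grad_Hcl_p₁ hns hKI, ← hc, hz]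
  exact power_balance _ _ _ (transpose_S34 _ _ _) hJ _ _ _ _ _ _ _

end IsAnnihilator

/-! ### Return to the original phase space. -/

theorem transpose_M (q : Fin n → ℝ) : (P.M q)ᵀ = P.M q := by
  simpa using (P.M_posDef q).isHermitian.eq

theorem transpose_Md (q : Fin n → ℝ) : (P.Md q)ᵀ = P.Md q := by
  simpa using (P.Md_posDef q).isHermitian.eq

/-- In this form `S1` and `S2` are the two column blocks of `M⁻¹ Md Tᵀ`. -/
theorem S1_eq (q : Fin n → ℝ) : P.S1 q = (P.M q)⁻¹ * P.Md q * (P.Gdag q)ᵀ := by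
  simp only [S1, Gdag, Matrix.transpose_mul, Matrix.transpose_nonsing_inv,
    Matrix.transpose_transpose, Matrix.mul_assoc]

theorem transpose_S1 (q : Fin n → ℝ) : (P.S1 q)ᵀ = P.Gdag q * (P.Md q * (P.M q)⁻¹) := by
  simp only [S1_eq, Matrix.transpose_mul, Matrix.transpose_nonsing_inv,
    Matrix.transpose_transpose, transpose_M, transpose_Md]

theorem transpose_S2 (q : Fin n → ℝ) : (P.S2 Gp q)ᵀ = Gp q * (P.Md q * (P.M q)⁻¹) := by
  simp only [S2, Matrix.transpose_mul, Matrix.transpose_nonsing_inv,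
    Matrix.transpose_transpose, transpose_M, transpose_Md]

theorem T_mulVec (q v : Fin n → ℝ) :
    P.T Gp q *ᵥ v = Sum.elim (P.Gdag q *ᵥ v) (Gp q *ᵥ v) := by
  rw [T, Matrix.fromRows_mulVec]

/-- The passage from the new coordinates `(q, p₁, p₂, ζ)` to the original phase space. -/
def toPhase (P : MechSystem n m) (Gp : (Fin n → ℝ) → Matrix (Fin s) (Fin n) ℝ)
    (x : (Fin n → ℝ) × (Fin m → ℝ) × (Fin s → ℝ) × (Fin m → ℝ)) :
    (Fin n → ℝ) × (Fin n → ℝ) :=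
  (x.1, P.Tinv Gp x.1 *ᵥ Sum.elim x.2.1 x.2.2.1)

theorem differentiable_H {X : Type*} [NormedAddCommGroup X] [NormedSpace ℝ X]
    {q p : X → Fin n → ℝ} (hq : ContDiff ℝ 2 q) (hp : ContDiff ℝ 2 p) :
    Differentiable ℝ fun x => P.H (q x) (p x) := (contDiff_H hq hp).differentiable two_ne_zero

namespace IsAnnihilator

variable (hG : P.IsAnnihilator Gp) (hns : m + s = n)
include hG

theorem differentiable_Tinv_mulVec (p : Fin m ⊕ Fin s → ℝ) :
    Differentiable ℝ fun q => P.Tinv Gp q *ᵥ p :=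
  (hG.contDiff_Tinv.mulVec contDiff_const).differentiable two_ne_zero

theorem continuous_toPhase : Continuous (P.toPhase Gp) :=
  continuous_fst.prodMk ((hG.contDiff_Tinv.comp contDiff_fst).mulVec
    (contDiff_sumElim (contDiff_fst.comp contDiff_snd)
      (contDiff_fst.comp (contDiff_snd.comp contDiff_snd)))).continuous

include hns

theorem grad_HT_p (q : Fin n → ℝ) (p₁ : Fin m → ℝ) (p₂ : Fin s → ℝ) :
    Sum.elim (grad (fun p' => P.HT Gp q p' p₂) p₁) (grad (fun p' => P.HT Gp q p₁ p') p₂) =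
      (P.Tinv Gp q)ᵀ *ᵥ grad (fun p' => P.H q p') (P.Tinv Gp q *ᵥ Sum.elim p₁ p₂) := by
  have hH : DifferentiableAt ℝ (fun p' => P.H q p') (P.Tinv Gp q *ᵥ Sum.elim p₁ p₂) :=
    differentiable_H contDiff_const contDiff_id _
  rw [Tinv, Matrix.transpose_fromCols, Matrix.fromRows_mulVec]
  simp only [hG.HT_eq_H hns, Tinv, Matrix.fromCols_mulVec_sumElim] at hH ⊢
  set g := grad (fun p' => P.H q p')
    (P.G q *ᵥ p₁ + ((Gp q)ᵀ * (Gp q * (Gp q)ᵀ)⁻¹) *ᵥ p₂) with hg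
  congr 1
  · refine grad_eq_of_forall fun v => ?_
    have h1 : HasFDerivAt (fun p' => P.G q *ᵥ p' + ((Gp q)ᵀ * (Gp q * (Gp q)ᵀ)⁻¹) *ᵥ p₂)
        (LinearMap.toContinuousLinearMap (P.G q).mulVecLin) p₁ :=
      (LinearMap.toContinuousLinearMap (P.G q).mulVecLin).hasFDerivAt.add_const _
    have h2 := hH.hasFDerivAt.comp p₁ h1
    refine (DFunLike.congr_fun h2.fderiv v).trans ?_
    rw [ContinuousLinearMap.comp_apply, fderiv_eq_grad_dotProduct, ← hg, Matrix.mulVec_transpose,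
      ← Matrix.dotProduct_mulVec]
    rfl
  · refine grad_eq_of_forall fun v => ?_
    have h1 : HasFDerivAt (fun p' => P.G q *ᵥ p₁ + ((Gp q)ᵀ * (Gp q * (Gp q)ᵀ)⁻¹) *ᵥ p')
        (LinearMap.toContinuousLinearMap ((Gp q)ᵀ * (Gp q * (Gp q)ᵀ)⁻¹).mulVecLin) p₂ :=
      (LinearMap.toContinuousLinearMap
        ((Gp q)ᵀ * (Gp q * (Gp q)ᵀ)⁻¹).mulVecLin).hasFDerivAt.const_add _
    have h2 := hH.hasFDerivAt.comp p₂ h1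
    refine (DFunLike.congr_fun h2.fderiv v).trans ?_
    rw [ContinuousLinearMap.comp_apply, fderiv_eq_grad_dotProduct, ← hg, Matrix.mulVec_transpose,
      ← Matrix.dotProduct_mulVec]
    rfl

/-- The first block column of `Tinv` is `G`, so this gradient is the passive output: the link
between dissipation and detectability. -/
theorem grad_HT_p₁ (q : Fin n → ℝ) (p₁ : Fin m → ℝ) (p₂ : Fin s → ℝ) :
    grad (fun p' => P.HT Gp q p' p₂) p₁ =
      (P.G q)ᵀ *ᵥ grad (fun p' => P.H q p') (P.Tinv Gp q *ᵥ Sum.elim p₁ p₂) := by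
  have h := hG.grad_HT_p hns q p₁ p₂
  conv_rhs at h => rw [Tinv, Matrix.transpose_fromCols, Matrix.fromRows_mulVec, ← Tinv]
  funext i
  exact congrFun h (Sum.inl i)

theorem grad_H_p_eq (q : Fin n → ℝ) (p₁ : Fin m → ℝ) (p₂ : Fin s → ℝ) :
    (P.Gdag q)ᵀ *ᵥ grad (fun p' => P.HT Gp q p' p₂) p₁ +
      (Gp q)ᵀ *ᵥ grad (fun p' => P.HT Gp q p₁ p') p₂ =
    grad (fun p' => P.H q p') (P.Tinv Gp q *ᵥ Sum.elim p₁ p₂) := by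
  rw [← Matrix.fromCols_mulVec_sumElim, ← Matrix.transpose_fromRows, ← T, hG.grad_HT_p hns,
    Matrix.mulVec_mulVec, ← Matrix.transpose_mul, hG.Tinv_mul_T hns, Matrix.transpose_one,
    Matrix.one_mulVec]

/-- With the new momenta fixed, the old momentum `Tinv q *ᵥ p` moves with `q`; the second term is
that contribution, which the first term of `Jp` later cancels. -/
theorem grad_HT_q (q : Fin n → ℝ) (p₁ : Fin m → ℝ) (p₂ : Fin s → ℝ) :
    grad (fun q' => P.HT Gp q' p₁ p₂) q =
      grad (fun q' => P.H q' (P.Tinv Gp q *ᵥ Sum.elim p₁ p₂)) q +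
      (jacobian (fun q' => P.Tinv Gp q' *ᵥ Sum.elim p₁ p₂) q)ᵀ *ᵥ
        grad (fun p' => P.H q p') (P.Tinv Gp q *ᵥ Sum.elim p₁ p₂) := by
  refine grad_eq_of_forall fun v => ?_
  have hH : DifferentiableAt ℝ (fun y : (Fin n → ℝ) × (Fin n → ℝ) => P.H y.1 y.2)
      (q, P.Tinv Gp q *ᵥ Sum.elim p₁ p₂) := differentiable_H contDiff_fst contDiff_snd _
  have hT := hG.differentiable_Tinv_mulVec (Sum.elim p₁ p₂) q
  simp only [hG.HT_eq_H hns]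
  have h : HasFDerivAt (fun q' => P.H q' (P.Tinv Gp q' *ᵥ Sum.elim p₁ p₂)) _ q :=
    HasFDerivAt.comp (g := fun y : (Fin n → ℝ) × (Fin n → ℝ) => P.H y.1 y.2)
      (f := fun q' => (q', P.Tinv Gp q' *ᵥ Sum.elim p₁ p₂)) q hH.hasFDerivAt
      ((hasFDerivAt_id q).prodMk hT.hasFDerivAt)
  rw [h.fderiv, ContinuousLinearMap.comp_apply, fderiv_prod_apply hH]
  simp only [ContinuousLinearMap.prod_apply, fderiv_eq_grad_dotProduct,
    fderiv_eq_jacobian_mulVec hT, ContinuousLinearMap.id_apply]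
  rw [add_dotProduct, Matrix.dotProduct_mulVec _ (jacobian _ _), Matrix.mulVec_transpose]

omit hns in
/-- The derivative of the passage to the original phase space. -/
theorem hasDerivWithinAt_toPhase {x : ℝ → (Fin n → ℝ) × (Fin m → ℝ) × (Fin s → ℝ) × (Fin m → ℝ)}
    {v : (Fin n → ℝ) × (Fin m → ℝ) × (Fin s → ℝ) × (Fin m → ℝ)} {S : Set ℝ} {t : ℝ}
    (hx : HasDerivWithinAt x v S t) :
    HasDerivWithinAt (fun t => P.toPhase Gp (x t))
      (v.1, jacobian (fun q' => P.Tinv Gp q' *ᵥ Sum.elim (x t).2.1 (x t).2.2.1) (x t).1 *ᵥ v.1 +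
        P.Tinv Gp (x t).1 *ᵥ Sum.elim v.2.1 v.2.2.1) S t := by
  have hΨ : DifferentiableAt ℝ (fun y : (Fin n → ℝ) × (Fin m ⊕ Fin s → ℝ) =>
      P.Tinv Gp y.1 *ᵥ y.2) ((x t).1, Sum.elim (x t).2.1 (x t).2.2.1) :=
    ((hG.contDiff_Tinv.comp contDiff_fst).mulVec contDiff_snd).differentiable two_ne_zero _
  have hp : HasDerivWithinAt (fun t => Sum.elim (x t).2.1 (x t).2.2.1)
      (Sum.elim v.2.1 v.2.2.1) S t := by
    rw [hasDerivWithinAt_pi]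
    rintro (i | i)
    · exact hasDerivWithinAt_pi.1 hx.snd.fst i
    · exact hasDerivWithinAt_pi.1 hx.snd.snd.fst i
  have hq : HasDerivWithinAt (fun t => (x t).1) v.1 S t :=
    (hasFDerivAt_fst (𝕜 := ℝ) (p := x t)).comp_hasDerivWithinAt t hx
  refine hq.prodMk ?_
  have h := hΨ.hasFDerivAt.comp_hasDerivWithinAt t (hq.prodMk hp)
  rw [fderiv_prod_apply hΨ] at h
  simp only [fderiv_eq_jacobian_mulVec (hG.differentiable_Tinv_mulVec _ _), fderiv_mulVec] at h
  exact h

end IsAnnihilator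

/-! ### Reduction to the undisturbed system, and the conclusion. -/

namespace IsAnnihilator

variable (hG : P.IsAnnihilator Gp) (hns : m + s = n) (hKI : KIᵀ = KI)
include hG hns hKI

/-- Where the energy is not dissipated, the closed loop is the undisturbed original system in the
new coordinates. -/
theorem openLoop_toPhase {c : Fin m → ℝ} (hc : (Jc1 - Rc1) *ᵥ (KI *ᵥ c) = d)
    {x : (Fin n → ℝ) × (Fin m → ℝ) × (Fin s → ℝ) × (Fin m → ℝ)}
    (ha : grad (fun p' => P.HT Gp x.1 p' x.2.2.1) x.2.1 = 0)
    (hw : KI *ᵥ (x.2.1 - c - x.2.2.2) = 0) :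
    P.openLoop 0 0 (P.toPhase Gp x) =
      ((P.closedLoop Gp KI Jc1 Rc1 Rc2 d x).1,
        jacobian (fun q' => P.Tinv Gp q' *ᵥ Sum.elim x.2.1 x.2.2.1) x.1 *ᵥ
          (P.closedLoop Gp KI Jc1 Rc1 Rc2 d x).1 +
        P.Tinv Gp x.1 *ᵥ Sum.elim (P.closedLoop Gp KI Jc1 Rc1 Rc2 d x).2.1
          (P.closedLoop Gp KI Jc1 Rc1 Rc2 d x).2.2.1) := by
  obtain ⟨q, p₁, p₂, ζ⟩ := x
  dsimp only at ha hw ⊢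
  have hz : KI *ᵥ (p₁ - ζ) = KI *ᵥ c := by
    have h : p₁ - ζ = (p₁ - c - ζ) + c := by abel
    rw [h, Matrix.mulVec_add, hw, zero_add]
  have hgp := hG.grad_H_p_eq hns q p₁ p₂
  have hy := hG.grad_HT_p₁ hns q p₁ p₂
  have hq := hG.grad_HT_q hns q p₁ p₂
  rw [ha] at hy
  rw [ha, Matrix.mulVec_zero, zero_add] at hgp
  set gp := grad (fun p' => P.H q p') (P.Tinv Gp q *ᵥ Sum.elim p₁ p₂) with hgp_def
  set b := grad (fun p' => P.HT Gp q p₁ p') p₂ with hb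
  set g := grad (fun q' => P.HT Gp q' p₁ p₂) q with hg
  set B := jacobian (fun q' => P.Tinv Gp q' *ᵥ Sum.elim p₁ p₂) q with hB
  -- When `a = 0` and `w = 0`, the rates of `p₁` and `p₂` are the two blocks of `T r`. Hence `Tinv`
  -- returns `r`, and the old momentum has rate `B q̇ + r`.
  set r : Fin n → ℝ := -((P.Md q * (P.M q)⁻¹) *ᵥ g) + P.Jp Gp q p₁ p₂ *ᵥ gp with hr
  have hv1 : (P.closedLoop Gp KI Jc1 Rc1 Rc2 d (q, p₁, p₂, ζ)).1 =
      ((P.M q)⁻¹ * P.Md q) *ᵥ gp := by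
    simp only [closedLoop, grad_Hcl_p₂, grad_Hcl_ζ hKI, hG.grad_Hcl_p₁ hns hKI, ha, ← hb, hz]
    rw [← hgp, Matrix.mulVec_mulVec, ← S2, zero_add, Matrix.mulVec_neg]
    abel
  have h32 : P.Gdag q *ᵥ r = -((P.S1 q)ᵀ *ᵥ g) + P.S32 Gp q p₁ p₂ *ᵥ b := by
    rw [hr, ← hgp, Matrix.mulVec_add, Matrix.mulVec_neg, transpose_S1, S32]
    simp only [← Matrix.mulVec_mulVec]
  have h34 : Gp q *ᵥ r = -((P.S2 Gp q)ᵀ *ᵥ g) + P.S34 Gp q p₁ p₂ *ᵥ b := by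
    rw [hr, ← hgp, Matrix.mulVec_add, Matrix.mulVec_neg, transpose_S2, S34]
    simp only [← Matrix.mulVec_mulVec]
  have hv2 : (P.closedLoop Gp KI Jc1 Rc1 Rc2 d (q, p₁, p₂, ζ)).2.1 = P.Gdag q *ᵥ r := by
    simp only [closedLoop, grad_Hcl_q, grad_Hcl_p₂, grad_Hcl_ζ hKI, hG.grad_Hcl_p₁ hns hKI, ha,
      ← hb, ← hg, hz]
    rw [h32, ← hc, Matrix.sub_mulVec _ Rc2, zero_add, Matrix.mulVec_neg]
    abel
  have hv3 : (P.closedLoop Gp KI Jc1 Rc1 Rc2 d (q, p₁, p₂, ζ)).2.2.1 = Gp q *ᵥ r := by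
    simp only [closedLoop, grad_Hcl_q, grad_Hcl_p₂, grad_Hcl_ζ hKI, hG.grad_Hcl_p₁ hns hKI, ha,
      ← hb, ← hg, hz]
    rw [h34, zero_add, Matrix.mulVec_neg]
    abel
  rw [hv1, hv2, hv3, ← T_mulVec, Matrix.mulVec_mulVec _ (P.Tinv Gp q), hG.Tinv_mul_T hns,
    Matrix.one_mulVec]
  refine Prod.ext rfl ?_
  simp only [openLoop, toPhase, ← hgp_def]
  -- The term `B q̇` cancels the `-B M⁻¹ Md` part of `Jp`, its `Md M⁻¹ Bᵀ` part cancels the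
  -- chain-rule term in the `q`-gradient, and the damping vanishes since `Gᵀ gp = 0`.
  rw [hr, hq, Jp, Rd]
  simp only [Matrix.sub_mulVec, Matrix.add_mulVec, Matrix.mulVec_add, ← Matrix.mulVec_mulVec,
    ← hy, Matrix.mulVec_zero, sub_self, ← hB, Matrix.mul_assoc]
  abel

theorem isSolution_toPhase {c : Fin m → ℝ} (hc : (Jc1 - Rc1) *ᵥ (KI *ᵥ c) = d)
    {x : ℝ → (Fin n → ℝ) × (Fin m → ℝ) × (Fin s → ℝ) × (Fin m → ℝ)}
    (hx : IsSolution (P.closedLoop Gp KI Jc1 Rc1 Rc2 d) x)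
    (ha : ∀ t, 0 ≤ t → grad (fun p' => P.HT Gp (x t).1 p' (x t).2.2.1) (x t).2.1 = 0)
    (hw : ∀ t, 0 ≤ t → KI *ᵥ ((x t).2.1 - c - (x t).2.2.2) = 0) :
    IsSolution (P.openLoop 0 0) fun t => P.toPhase Gp (x t) := by
  intro t ht
  rw [hG.openLoop_toPhase hns hKI hc (ha t ht) (hw t ht)]
  exact hG.hasDerivWithinAt_toPhase (hx t ht)

omit hKI in
-- Either the phase point differs from `(qstar, 0)` and the mechanical energy is strictly larger, or
-- it coincides, so that `p₁ = p₂ = 0` by invertibility of `T`, ζ differs from `-c`, and the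
-- controller energy is positive.
theorem lyapunov_strict_min (hKI : KI.PosDef) (c : Fin m → ℝ) :
    ∀ᶠ x in 𝓝[≠] ((P.qstar, 0, 0, -c) :
        (Fin n → ℝ) × (Fin m → ℝ) × (Fin s → ℝ) × (Fin m → ℝ)),
      P.lyapunov Gp KI c (P.qstar, 0, 0, -c) < P.lyapunov Gp KI c x := by
  have h0 : P.toPhase Gp (P.qstar, 0, 0, -c) = (P.qstar, 0) := by simp [toPhase]
  have hmin := eventually_nhdsWithin_iff.1 P.strict_min
  rw [← h0] at hmin
  have hev := (hG.continuous_toPhase.tendsto _).eventually hmin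
  rw [eventually_nhdsWithin_iff]
  filter_upwards [hev] with x hx hne
  have hWs : P.lyapunov Gp KI c (P.qstar, 0, 0, -c) = hamiltonian P.Md P.Vd P.qstar 0 := by
    simp [lyapunov, hG.HT_eq_H hns, Hc, H]
  have hWx : P.lyapunov Gp KI c x = hamiltonian P.Md P.Vd (P.toPhase Gp x).1 (P.toPhase Gp x).2 +
      Hc KI (x.2.1 - c) x.2.2.2 := by
    simp [lyapunov, hG.HT_eq_H hns, H, toPhase]
  have hpos := posDef_dotProduct_nonneg hKI (x.2.1 - c - x.2.2.2)
  rw [hWs, hWx]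
  by_cases hΦ : P.toPhase Gp x = P.toPhase Gp (P.qstar, 0, 0, -c)
  · rw [h0] at hΦ
    obtain ⟨q, p₁, p₂, ζ⟩ := x
    obtain ⟨hq, hp⟩ := Prod.mk.inj hΦ
    have hp0 : Sum.elim p₁ p₂ = 0 := by
      have h := congrArg (fun v => P.T Gp q *ᵥ v) hp
      simpa only [Matrix.mulVec_mulVec, hG.T_mul_Tinv, Matrix.one_mulVec, Matrix.mulVec_zero] using h
    have h1 : p₁ = 0 := funext fun i => congrFun hp0 (Sum.inl i)
    have h2 : p₂ = 0 := funext fun i => congrFun hp0 (Sum.inr i)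
    dsimp only at hq
    subst h1 h2 hq
    have hζ : (0 : Fin m → ℝ) - c - ζ ≠ 0 := fun h => hne <| by
      have : ζ = -c := by rw [← sub_eq_zero.1 h, zero_sub]
      simp [this]
    have := hpos.lt_of_ne' (mt (posDef_dotProduct_eq_zero_iff hKI).1 hζ)
    rw [hΦ, Hc]
    dsimp only at this ⊢
    linarith
  · have := hx hΦ
    rw [Hc]
    linarith

omit hKI in
theorem isAsymptoticallyStable_closedLoop (hKI : KI.PosDef) (hJ : Jc1ᵀ = -Jc1)
    (hR₁ : Rc1.PosDef) (hR₂ : Rc2.PosDef) {c : Fin m → ℝ}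
    (hc : (Jc1 - Rc1) *ᵥ (KI *ᵥ c) = d)
    (hdetect : IsDetectable (P.openLoop 0 0) P.output (P.qstar, 0)) :
    IsAsymptoticallyStable (P.closedLoop Gp KI Jc1 Rc1 Rc2 d) (P.qstar, 0, 0, -c) := by
  have hKs : KIᵀ = KI := by simpa using hKI.isHermitian.eq
  have hdW := fun x => hG.fderiv_lyapunov_closedLoop (Rc1 := Rc1) (Rc2 := Rc2) hns hKs hJ hc x
    rfl rfl
  refine isAsymptoticallyStable_of_lyapunov (hG.contDiff_closedLoop hns KI Jc1 Rc1 Rc2 d)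
    (hG.differentiable_lyapunov hns KI c) (hG.lyapunov_strict_min hns hKI c) (fun x => ?_) ?_
  · rw [hdW]
    have h1 := posDef_dotProduct_nonneg hR₁
      (grad (fun p' => P.HT Gp x.1 p' x.2.2.1) x.2.1 + KI *ᵥ (x.2.1 - c - x.2.2.2))
    have h2 := posDef_dotProduct_nonneg hR₂ (grad (fun p' => P.HT Gp x.1 p' x.2.2.1) x.2.1)
    linarith
  obtain ⟨N, hN, hconv⟩ := hdetect
  have h0 : P.toPhase Gp (P.qstar, 0, 0, -c) = (P.qstar, 0) := by simp [toPhase]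
  refine ⟨P.toPhase Gp ⁻¹' N, hG.continuous_toPhase.continuousAt (h0 ▸ hN), ?_⟩
  intro x hx hx0 hxW
  have haw : ∀ t, 0 ≤ t → grad (fun p' => P.HT Gp (x t).1 p' (x t).2.2.1) (x t).2.1 = 0 ∧
      KI *ᵥ ((x t).2.1 - c - (x t).2.2.2) = 0 := by
    intro t ht
    have h := hxW t ht
    rw [hdW] at h
    have h1 := posDef_dotProduct_nonneg hR₁ (grad (fun p' => P.HT Gp (x t).1 p' (x t).2.2.1)
      (x t).2.1 + KI *ᵥ ((x t).2.1 - c - (x t).2.2.2))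
    have h2 := posDef_dotProduct_nonneg hR₂
      (grad (fun p' => P.HT Gp (x t).1 p' (x t).2.2.1) (x t).2.1)
    -- Two nonnegative terms sum to zero: the `Rc2` term gives `a = 0`, then the `Rc1` term gives `w
    -- = 0`.
    have ha := (posDef_dotProduct_eq_zero_iff hR₂).1 (by linarith : _ = (0 : ℝ))
    have hw := (posDef_dotProduct_eq_zero_iff hR₁).1 (by linarith : _ = (0 : ℝ))
    rw [ha, zero_add] at hw
    exact ⟨ha, hw⟩
  have he : ∀ t, 0 ≤ t → (x t).2.2.2 = (x t).2.1 - c := fun t ht => by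
    have h := (posDef_dotProduct_eq_zero_iff hKI).1
      (by rw [(haw t ht).2, dotProduct_zero] :
        ((x t).2.1 - c - (x t).2.2.2) ⬝ᵥ (KI *ᵥ ((x t).2.1 - c - (x t).2.2.2)) = 0)
    exact (sub_eq_zero.1 h).symm
  have hlim := hconv _ (hG.isSolution_toPhase hns hKs hc hx (fun t ht => (haw t ht).1)
    fun t ht => (haw t ht).2) hx0 fun t ht => by
      rw [← (haw t ht).1, hG.grad_HT_p₁ hns]
      rfl
  have hq : Filter.Tendsto (fun t => (x t).1) Filter.atTop (𝓝 P.qstar) := hlim.fst_nhds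
  -- The new momenta are recovered by applying `T` at the moving configuration, jointly continuous
  -- in `(q, p)`.
  have hp : Filter.Tendsto (fun t => Sum.elim (x t).2.1 (x t).2.2.1) Filter.atTop (𝓝 0) := by
    have hcont : Continuous fun y : (Fin n → ℝ) × (Fin n → ℝ) => P.T Gp y.1 *ᵥ y.2 :=
      ((hG.contDiff_T.comp contDiff_fst).mulVec contDiff_snd).continuous
    have h := (hcont.tendsto (P.qstar, 0)).comp hlim
    simpa only [Function.comp_def, toPhase, Matrix.mulVec_mulVec, hG.T_mul_Tinv,
      Matrix.one_mulVec, Matrix.mulVec_zero] using h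
  rw [tendsto_pi_nhds] at hp
  have h₁ : Filter.Tendsto (fun t => (x t).2.1) Filter.atTop (𝓝 0) :=
    tendsto_pi_nhds.2 fun i => hp (Sum.inl i)
  have h₂ : Filter.Tendsto (fun t => (x t).2.2.1) Filter.atTop (𝓝 0) :=
    tendsto_pi_nhds.2 fun i => hp (Sum.inr i)
  have hζ : Filter.Tendsto (fun t => (x t).2.2.2) Filter.atTop (𝓝 (-c)) := by
    rw [← zero_sub]
    exact (h₁.sub_const c).congr' <|
      (Filter.eventually_ge_atTop 0).mono fun t ht => (he t ht).symm
  exact hq.prodMk_nhds (h₁.prodMk_nhds (h₂.prodMk_nhds hζ))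

end IsAnnihilator
end MechSystem
end IDAPBC

end

theorem mainTheorem3 {n m s : ℕ} (hns : m + s = n)
    (P : IDAPBC.MechSystem n m)
    (Gp : (Fin n → ℝ) → Matrix (Fin s) (Fin n) ℝ)
    (hGp_smooth : ∀ i j, ContDiff ℝ 2 fun q => Gp q i j)
    (hGp_rank : ∀ q, (Gp q).rank = s)
    (hGp_ann : ∀ q, Gp q * P.G q = 0)
    (KI Jc1 Rc1 Rc2 : Matrix (Fin m) (Fin m) ℝ)
    (hKI : KI.PosDef) (hJc1 : Jc1ᵀ = -Jc1) (hRc1 : Rc1.PosDef) (hRc2 : Rc2.PosDef)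
    (d : Fin m → ℝ)
    (hdetect : IDAPBC.IsDetectable (P.openLoop 0 0) P.output (P.qstar, 0)) :
    IDAPBC.IsAsymptoticallyStable (P.closedLoop Gp KI Jc1 Rc1 Rc2 d)
      (P.equilibrium s KI Jc1 Rc1 d) := by
  have hK := (Matrix.isUnit_iff_isUnit_det _).1 hKI.isUnit
  have hJR := (Matrix.isUnit_iff_isUnit_det _).1 (IDAPBC.isUnit_skew_sub_posDef hJc1 hRc1)
  refine IDAPBC.MechSystem.IsAnnihilator.isAsymptoticallyStable_closedLoop
    ⟨hGp_smooth, hGp_rank, hGp_ann⟩ hns hKI hJc1 hRc1 hRc2 ?_ hdetect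
  rw [Matrix.mulVec_mulVec _ KI, Matrix.mul_nonsing_inv _ hK, Matrix.one_mulVec,
    Matrix.mulVec_mulVec, Matrix.mul_nonsing_inv _ hJR, Matrix.one_mulVec]
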